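/- Let $(W_n)_{n\ge 1}$ be a simple symmetric random walk on $\mathbb{Z}$ with $W_1=1$ (independent steps, each equal to $+1$ or $-1$ with probability $1/2$), let $\sigma=\inf\{n\ge 1: W_n=0\}$ be its hitting time of $0$, and let $T_n=W_{\min(n,\sigma)}$ be the walk stopped at $\sigma$. For $m\ge 1$ let $d(m)$ be the number of sites that are visited exactly once by $T_1,\dots,T_m$, that is, the number of $s\in\mathbb{Z}$ for which there is exactly one $k\in\{1,\dots,m\}$ with $T_k=s$. Then, as $M\to\infty$ through the real numbers (in particular, through the integers), $$\lim_{M\to\infty}\frac{\log \mathbb{P}\left(\max_{1\le m\le\sigma-1} d(m)\ge M\right)}{2\sqrt{M}}=-1 .$$ -/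

import Mathlib

open MeasureTheory ProbabilityTheory Filter Topology

noncomputable section

/-- `W` is, from time `1` on, a simple random walk on `ℤ` that starts at `W 1 = 1`: its steps
`W (n + 1) - W n`, `n ≥ 1`, are independent and each equals `1` or `-1` with probability `1 / 2`.
The value `W 0` plays no role. -/
structure IsSimpleRandomWalkFromOne {Ω : Type*} [MeasurableSpace Ω] (W : ℕ → Ω → ℤ)
    (μ : Measure Ω) : Prop where
  measurable : ∀ n, 1 ≤ n → Measurable (W n)
  start : ∀ᵐ ω ∂μ, W 1 ω = 1
  indep : iIndepFun (fun (n : ℕ) (ω : Ω) => W (n + 2) ω - W (n + 1) ω) μ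
  step_up : ∀ n, 1 ≤ n → μ {ω | W (n + 1) ω - W n ω = 1} = 1 / 2
  step_down : ∀ n, 1 ≤ n → μ {ω | W (n + 1) ω - W n ω = -1} = 1 / 2

/-- The hitting time `σ = inf {n ≥ 1 | W n = 0}` of the origin (`⊤` if the origin is never hit). -/
def hitZero {Ω : Type*} (W : ℕ → Ω → ℤ) : Ω → WithTop ℕ :=
  hittingAfter W {0} 1

/-- The walk `T` obtained from `W` by stopping it when it hits the origin. -/
def stoppedWalk {Ω : Type*} (W : ℕ → Ω → ℤ) : ℕ → Ω → ℤ :=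
  stoppedProcess W (hitZero W)

/-- The set of sites visited exactly once by `T 1, …, T m`. -/
def onceVisited {Ω : Type*} (T : ℕ → Ω → ℤ) (m : ℕ) (ω : Ω) : Set ℤ :=
  {s | ∃ k ∈ Set.Icc 1 m, T k ω = s ∧ ∀ l ∈ Set.Icc 1 m, l ≠ k → T l ω ≠ s}

/-- The number `d(m)` of sites visited exactly once by `T 1, …, T m`. -/
def onceVisitedCount {Ω : Type*} (T : ℕ → Ω → ℤ) (m : ℕ) (ω : Ω) : ℕ :=
  (onceVisited T m ω).ncard

/-- The maximum of `d(m)` over the times `1 ≤ m ≤ σ - 1`, for the walk stopped at the origin. It is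
a supremum in `ℕ∞`, so that it also has its natural meaning on the null event `σ = ⊤`. -/
def maxOnceVisited {Ω : Type*} (W : ℕ → Ω → ℤ) (ω : Ω) : ℕ∞ :=
  ⨆ (m : ℕ) (_ : 1 ≤ m ∧ WithTop.some (m + 1) ≤ hitZero W ω),
    ((onceVisitedCount (stoppedWalk W) m ω : ℕ) : ℕ∞)

end

/-! The visited set is always an interval `{1, …, h}`, so the number of sites visited once can grow
only when a new maximum is reached. It therefore suffices to observe the walk at its new maxima.
There the list of sites visited once is a Markov chain: the walk steps up at once, or makes an
excursion whose minimum `m` wipes out every listed site `≥ m`, or dies at `0`. Gambler's ruin gives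
the transition weights. `hasSum_successMass` identifies the success probability `Q M` of the walk
with the total success mass of this chain.

Let `A M` be the sum over all heights of the probability of being there without success so far. Two
facts determine the asymptotics.

Renewal (`topLaw_eq_renewal`): let `i + 1` be the lowest site visited once, other than the current
maximum. Since the direct step up from `i + 1`, the walk has stayed above it, so it is a fresh walk
killed at `i + 1` that needs one site less. Success and survival masses for `M + 1` are thus
convolutions of those for `M` with the same weights, and summation gives `A (M + 1) = Q (M + 1) / Q
M * (2 + A M)`.

Optional stopping (`mass_balance`): the survival mass at height `n + 1` is at most `1 / (n + 1)` and
at least `1 / (n + 1) - Q M`. With a first moment bound for the tail, harmonic sums give `A M = -log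
(Q M) + O(log M)`.

For `S = -log Q + log A` the recursion reads `S (M + 1) = S M + log (1 + 2 / A M)`. Since `A` is
asymptotic to `S`, the square of `S` grows by about `4` per step, so `S M ~ 2 √M`. As `log (A M) =
O(log M)`, the same holds for `-log (Q M)`. -/

/-! ### The chain of new maxima and optional stopping. -/

/-- One step of the chain of new maxima of the walk. In state `L` (the sites visited exactly once
when the maximum `s` is first reached) the walk goes to `s + 1` directly, or after an excursion with
minimum `m`, or it dies at the origin. States with at least `M` sites are absorbed. -/
noncomputable def topStep (M s : ℕ) (g : List ℕ → ℝ) (L : List ℕ) : ℝ :=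
  if M ≤ L.length then 0 else
    1 / 2 * g ((s + 1) :: L) + ∑ m ∈ Finset.Ico 1 s,
      1 / (((s : ℝ) + 1 - m) * ((s : ℝ) + 2 - m)) * g ((s + 1) :: L.filter (· < m))

/-- Integral of `g` against the law of the state in which the maximum `n + 1` is first reached,
restricted to the event that no earlier state had `M` sites. -/
noncomputable def topLaw (M : ℕ) : ℕ → (List ℕ → ℝ) → ℝ
  | 0, g => g [1]
  | n + 1, g => topLaw M n (topStep M (n + 1) g)

/-- Probability that `M` sites visited once are first present when the maximum `n + 1` is reached. -/
noncomputable def successMass (M n : ℕ) : ℝ := topLaw M n fun L => if M ≤ L.length then 1 else 0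

/-- Probability that the maximum `n + 1` is reached without success. -/
noncomputable def aliveMass (M n : ℕ) : ℝ := topLaw M n fun L => if M ≤ L.length then 0 else 1

/-- Probability that the maximum `n + 1` is reached without earlier success when all lower sites
have been visited more than once. -/
noncomputable def renewalMass (M n : ℕ) : ℝ := topLaw M n fun L => if L = [n + 1] then 1 else 0

lemma topStep_add (M s : ℕ) (f g : List ℕ → ℝ) :
    topStep M s (fun L => f L + g L) = fun L => topStep M s f L + topStep M s g L := by
  funext L
  unfold topStep
  split_ifs
  · simp
  · simp only [mul_add, Finset.sum_add_distrib]; ring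

lemma topStep_mul_const (M s : ℕ) (f : List ℕ → ℝ) (c : ℝ) :
    topStep M s (fun L => f L * c) = fun L => topStep M s f L * c := by
  funext L
  unfold topStep
  split_ifs
  · simp
  · simp only [add_mul, Finset.sum_mul, mul_assoc]

lemma topLaw_add (M n : ℕ) (f g : List ℕ → ℝ) :
    topLaw M n (fun L => f L + g L) = topLaw M n f + topLaw M n g := by
  induction n generalizing f g with
  | zero => rfl
  | succ n ih => simp only [topLaw, topStep_add, ih]

lemma topLaw_mul_const (M n : ℕ) (f : List ℕ → ℝ) (c : ℝ) :
    topLaw M n (fun L => f L * c) = topLaw M n f * c := by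
  induction n generalizing f with
  | zero => rfl
  | succ n ih => simp only [topLaw, topStep_mul_const, ih]

lemma topStep_coeff_nonneg {s m : ℕ} (h : m ∈ Finset.Ico 1 s) :
    0 ≤ 1 / (((s : ℝ) + 1 - m) * ((s : ℝ) + 2 - m)) := by
  have : (m : ℝ) < s := by exact_mod_cast (Finset.mem_Ico.1 h).2
  apply div_nonneg zero_le_one (mul_nonneg _ _) <;> linarith

/-- The states that can occur when the maximum `s` is first reached. -/
def IsTopState (s : ℕ) (L : List ℕ) : Prop := ∃ K, L = s :: K ∧ ∀ x ∈ K, x < s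

lemma IsTopState.cons {s : ℕ} {L : List ℕ} (h : IsTopState s L) : IsTopState (s + 1) ((s + 1) :: L) := by
  obtain ⟨K, rfl, hK⟩ := h
  refine ⟨_, rfl, fun x hx => ?_⟩
  rcases List.mem_cons.1 hx with rfl | hx
  · omega
  · have := hK x hx; omega

lemma IsTopState.cons_filter {s m : ℕ} {L : List ℕ} (hm : m ≤ s) :
    IsTopState (s + 1) ((s + 1) :: L.filter (· < m)) := by
  refine ⟨_, rfl, fun x hx => ?_⟩
  simp only [List.mem_filter, decide_eq_true_eq] at hx
  omega

lemma topLaw_mono {M n : ℕ} {f g : List ℕ → ℝ} (h : ∀ L, IsTopState (n + 1) L → f L ≤ g L) :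
    topLaw M n f ≤ topLaw M n g := by
  induction n generalizing f g with
  | zero => exact h _ ⟨[], rfl, by simp⟩
  | succ n ih =>
    refine ih fun L hL => ?_
    unfold topStep
    split_ifs
    · exact le_rfl
    · gcongr with m hm
      · exact h _ hL.cons
      · exact topStep_coeff_nonneg hm
      · exact h _ (.cons_filter (Finset.mem_Ico.1 hm).2.le)

lemma topLaw_congr {M n : ℕ} {f g : List ℕ → ℝ} (h : ∀ L, IsTopState (n + 1) L → f L = g L) :
    topLaw M n f = topLaw M n g :=
  le_antisymm (topLaw_mono fun L hL => (h L hL).le) (topLaw_mono fun L hL => (h L hL).ge)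

lemma topLaw_nonneg {M n : ℕ} {f : List ℕ → ℝ} (h : ∀ L, 0 ≤ f L) : 0 ≤ topLaw M n f := by
  have h0 : topLaw M n (fun L => f L * 0) = 0 := by rw [topLaw_mul_const, mul_zero]
  rw [← h0]
  exact topLaw_mono fun L _ => by simpa using h L

lemma successMass_nonneg (M n : ℕ) : 0 ≤ successMass M n :=
  topLaw_nonneg fun L => by split_ifs <;> norm_num

lemma aliveMass_nonneg (M n : ℕ) : 0 ≤ aliveMass M n :=
  topLaw_nonneg fun L => by split_ifs <;> norm_num

lemma renewalMass_nonneg (M n : ℕ) : 0 ≤ renewalMass M n :=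
  topLaw_nonneg fun L => by split_ifs <;> norm_num

/-- Each term is `1 / (N + 1 - m) - 1 / (N + 2 - m)`, a difference of two gambler's ruin
probabilities, so the sum telescopes. -/
lemma sum_Ico_coeff (N : ℝ) (j : ℕ) (hj : (j : ℝ) < N) :
    ∑ m ∈ Finset.Ico 1 (j + 1), 1 / ((N + 1 - m) * (N + 2 - m)) = 1 / (N + 1 - j) - 1 / (N + 1) := by
  induction j with
  | zero => simp
  | succ j ih =>
    push_cast at hj
    rw [Finset.sum_Ico_succ_top (by omega), ih (by linarith)]
    have h1 : N + 1 - (j : ℝ) ≠ 0 := by linarith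
    have h2 : N + 1 - ((j : ℝ) + 1) ≠ 0 := by linarith
    have h3 : N + 2 - ((j : ℝ) + 1) ≠ 0 := by linarith
    push_cast
    field_simp
    ring

/-- The total transition weight is the probability of going from `s + 1` to `s + 2` before `0`. -/
lemma sum_topStep_coeff (s : ℕ) :
    1 / 2 + ∑ m ∈ Finset.Ico 1 (s + 1), 1 / ((((s + 1 : ℕ) : ℝ) + 1 - m) * (((s + 1 : ℕ) : ℝ) + 2 - m))
      = ((s : ℝ) + 1) / (s + 2) := by
  rw [sum_Ico_coeff _ _ (by push_cast; linarith)]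
  push_cast
  have h : (s : ℝ) + 1 + 1 - s = 2 := by ring
  rw [h]
  field_simp
  ring

/-- Optional stopping for the heights of the maxima. -/
lemma add_two_mul_mass (M n : ℕ) :
    ((n : ℝ) + 2) * (successMass M (n + 1) + aliveMass M (n + 1)) = (n + 1) * aliveMass M n := by
  have h1 : successMass M (n + 1) + aliveMass M (n + 1)
      = aliveMass M n * (((n : ℝ) + 1) / (n + 2)) := by
    rw [successMass, aliveMass, ← topLaw_add, aliveMass, ← topLaw_mul_const, topLaw]
    congr 1
    funext L
    unfold topStep
    split_ifs
    · simp
    · rw [one_mul, ← sum_topStep_coeff]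
      congr 1
      · dsimp only
        split_ifs <;> norm_num
      · refine Finset.sum_congr rfl fun m _ => ?_
        dsimp only
        split_ifs <;> simp
  rw [h1]
  field_simp

/-- The height of the stopped chain has mean `1`, its initial value; death counts as height `0`. -/
lemma mass_balance {M : ℕ} (n : ℕ) :
    ((n : ℝ) + 1) * aliveMass M n + ∑ k ∈ Finset.range (n + 1), ((k : ℝ) + 1) * successMass M k = 1 := by
  induction n with
  | zero =>
    simp only [zero_add, Finset.sum_range_one, aliveMass, successMass, topLaw]
    split_ifs <;> simp
  | succ n ih =>
    rw [Finset.sum_range_succ]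
    have := add_two_mul_mass M n
    push_cast
    linarith

/-! ### Renewal at the lowest site visited once. -/

/-- Excursions with minimum above `i + 1` act on `C` as in a walk killed at `i + 1`. Those reaching
`i + 1` or below erase the whole list and leave only the new maximum. The threshold drops to `M`
because the site `i + 1` counts. -/
lemma topStep_shift (M i k : ℕ) (g : List ℕ → ℝ) (C : List ℕ) :
    topStep (M + 1) (i + 1 + (k + 1)) g (C.map (· + (i + 1)) ++ [i + 1]) =
      topStep M (k + 1) (fun C => g (C.map (· + (i + 1)) ++ [i + 1])) C +
      (if M ≤ C.length then 0 else ∑ m ∈ Finset.Ico 1 (i + 2),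
        1 / ((((i + 1 + (k + 1) : ℕ) : ℝ) + 1 - m) * (((i + 1 + (k + 1) : ℕ) : ℝ) + 2 - m))) *
        g [i + 1 + (k + 1) + 1] := by
  unfold topStep
  by_cases hM : M ≤ C.length
  · simp [hM]
  · have hM' : ¬ (M + 1 ≤ (C.map (· + (i + 1)) ++ [i + 1]).length) := by simpa using hM
    rw [if_neg hM, if_neg hM, if_neg hM', ← Finset.sum_Ico_consecutive _ (by omega : 1 ≤ i + 2)
      (by omega : i + 2 ≤ i + 1 + (k + 1)), Finset.sum_mul, add_comm (∑ m ∈ Finset.Ico 1 (i + 2), _),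
      add_assoc (1 / 2 * _)]
    refine congrArg₂ _ ?_ (congrArg₂ _ ?_ ?_)
    · simp only [List.map_cons, List.cons_append]
      rw [show i + 1 + (k + 1) + 1 = k + 1 + 1 + (i + 1) by ring]
    · rw [show i + 2 = 1 + (i + 1) by ring, show i + 1 + (k + 1) = (k + 1) + (i + 1) by ring,
        ← Finset.sum_Ico_add']
      refine Finset.sum_congr rfl fun m hm => ?_
      congr 1
      · push_cast; congr 2 <;> ring
      · simp only [List.filter_append, List.filter_map, List.map_cons, List.cons_append]
        congr 2
        · ring
        · congr 1
          · congr 1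
            apply List.filter_congr
            simp
          · have := (Finset.mem_Ico.1 hm).1
            rw [List.filter_cons_of_pos] <;> simp; omega
    · refine Finset.sum_congr rfl fun m hm => ?_
      congr 2
      simp only [List.cons.injEq, true_and, List.filter_eq_nil_iff]
      have := (Finset.mem_Ico.1 hm).2
      intro x hx
      simp only [List.mem_append, List.mem_map, List.mem_singleton] at hx
      simp only [decide_eq_true_eq]
      rcases hx with ⟨y, _, rfl⟩ | rfl <;> omega

/-- Decomposition of the law of the state at the lowest site visited once. -/
lemma topLaw_eq_renewal {M : ℕ} (hM : 1 ≤ M) (n : ℕ) (g : List ℕ → ℝ) :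
    topLaw (M + 1) n g = renewalMass (M + 1) n * g [n + 1] +
      ∑ i ∈ Finset.range n, renewalMass (M + 1) i * (1 / 2) *
        topLaw M (n - 1 - i) fun C => g (C.map (· + (i + 1)) ++ [i + 1]) := by
  induction n generalizing g with
  | zero => simp [topLaw, renewalMass]
  | succ n ih =>
    -- The weight of the singleton state needs no evaluation: testing the identity on the indicator
    -- of `[n + 2]` forces `c` to be the renewal mass, since every other state ends in some `i + 1 <
    -- n + 2`.
    obtain ⟨c, hc⟩ : ∃ c : ℝ, ∀ g : List ℕ → ℝ, topLaw (M + 1) (n + 1) g = c * g [n + 2] +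
        ∑ i ∈ Finset.range (n + 1), renewalMass (M + 1) i * (1 / 2) *
          topLaw M (n - i) fun C => g (C.map (· + (i + 1)) ++ [i + 1]) := by
      refine ⟨renewalMass (M + 1) n * (∑ m ∈ Finset.Ico 1 (n + 1),
        1 / ((((n + 1 : ℕ) : ℝ) + 1 - m) * (((n + 1 : ℕ) : ℝ) + 2 - m))) +
        ∑ i ∈ Finset.range n, renewalMass (M + 1) i * (1 / 2) *
          topLaw M (n - 1 - i) fun C => if M ≤ C.length then 0 else ∑ m ∈ Finset.Ico 1 (i + 2),
        1 / ((((n + 1 : ℕ) : ℝ) + 1 - m) * (((n + 1 : ℕ) : ℝ) + 2 - m)), fun g => ?_⟩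
      have h1 : topStep (M + 1) (n + 1) g [n + 1] = 1 / 2 * g [n + 2, n + 1] +
          (∑ m ∈ Finset.Ico 1 (n + 1),
            1 / ((((n + 1 : ℕ) : ℝ) + 1 - m) * (((n + 1 : ℕ) : ℝ) + 2 - m))) * g [n + 2] := by
        rw [topStep, if_neg (by simp; omega), Finset.sum_mul]
        congr 1
        refine Finset.sum_congr rfl fun m hm => ?_
        have := (Finset.mem_Ico.1 hm).2
        rw [List.filter_cons_of_neg (by simp; omega), List.filter_nil]
      have h2 : ∀ i ∈ Finset.range n, renewalMass (M + 1) i * (1 / 2) * topLaw M (n - 1 - i)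
            (fun C => topStep (M + 1) (n + 1) g (C.map (· + (i + 1)) ++ [i + 1])) =
          renewalMass (M + 1) i * (1 / 2) *
            topLaw M (n - i) (fun C => g (C.map (· + (i + 1)) ++ [i + 1])) +
          renewalMass (M + 1) i * (1 / 2) *
          (topLaw M (n - 1 - i) fun C => if M ≤ C.length then 0 else ∑ m ∈ Finset.Ico 1 (i + 2),
            1 / ((((n + 1 : ℕ) : ℝ) + 1 - m) * (((n + 1 : ℕ) : ℝ) + 2 - m))) * g [n + 2] := by
        intro i hi
        obtain ⟨k, rfl⟩ : ∃ k, n = i + 1 + k := ⟨n - 1 - i, by have := Finset.mem_range.1 hi; omega⟩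
        have e1 : i + 1 + k - 1 - i = k := by omega
        have e2 : i + 1 + k - i = k + 1 := by omega
        rw [e1, e2, topLaw, mul_assoc _ _ (g _), ← topLaw_mul_const, ← mul_add, ← topLaw_add]
        congr 2
        funext C
        exact topStep_shift M i k g C
      rw [topLaw, ih, h1, Finset.sum_congr rfl h2, Finset.sum_add_distrib, Finset.sum_range_succ,
        Nat.sub_self, topLaw, ← Finset.sum_mul]
      simp only [List.map_cons, List.map_nil, List.singleton_append,
        show 1 + (n + 1) = n + 2 by ring]
      ring
    have hw : renewalMass (M + 1) (n + 1) = c := by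
      rw [renewalMass, hc, if_pos rfl, mul_one, add_eq_left]
      refine Finset.sum_eq_zero fun i hi => ?_
      have := Finset.mem_range.1 hi
      have h0 : (fun C : List ℕ => if C.map (· + (i + 1)) ++ [i + 1] = [n + 1 + 1] then (1 : ℝ) else 0)
          = fun _ => 0 * 0 := by
        funext C
        rw [if_neg, mul_zero]
        intro h
        have := congrArg (fun l => l.getLast?) h
        simp at this
        omega
      rw [h0, topLaw_mul_const]; simp
    rw [hc, hw]; rfl

lemma successMass_succ {M : ℕ} (hM : 1 ≤ M) (n : ℕ) :
    successMass (M + 1) n =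
      ∑ i ∈ Finset.range n, renewalMass (M + 1) i * (1 / 2) * successMass M (n - 1 - i) := by
  rw [successMass, topLaw_eq_renewal hM, if_neg (by simp; omega), mul_zero, zero_add]
  simp [successMass]

lemma aliveMass_succ {M : ℕ} (hM : 1 ≤ M) (n : ℕ) :
    aliveMass (M + 1) n = renewalMass (M + 1) n +
      ∑ i ∈ Finset.range n, renewalMass (M + 1) i * (1 / 2) * aliveMass M (n - 1 - i) := by
  rw [aliveMass, topLaw_eq_renewal hM, if_neg (by simp; omega), mul_one]
  simp [aliveMass]

lemma aliveMass_one (n : ℕ) : aliveMass 1 n = 0 := by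
  have h0 : topLaw 1 n (fun _ => 0) = 0 := by simpa using topLaw_mul_const 1 n (fun _ => 0) 0
  refine (topLaw_congr ?_).trans h0
  rintro L ⟨K, rfl, _⟩
  simp

open scoped ENNReal in
lemma ENNReal.tsum_shifted_convolution (f g : ℕ → ℝ≥0∞) :
    ∑' n, ∑ i ∈ Finset.range n, f i * g (n - 1 - i) = (∑' n, f n) * ∑' n, g n := by
  rw [tsum_eq_zero_add' ENNReal.summable, Finset.range_zero, Finset.sum_empty, zero_add]
  have h1 : ∀ n, ∑ i ∈ Finset.range (n + 1), f i * g (n + 1 - 1 - i)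
      = ∑ p ∈ Finset.HasAntidiagonal.antidiagonal n, f p.1 * g p.2 := fun n => by
    rw [Finset.Nat.sum_antidiagonal_eq_sum_range_succ (fun i j => f i * g j)]; rfl
  simp only [h1, ← ENNReal.tsum_mul_right, ← ENNReal.tsum_mul_left]
  rw [ENNReal.tsum_comm, ← ENNReal.tsum_prod (f := fun i j => f i * g j), ← Finset.HasAntidiagonal.sigmaAntidiagonalEquivProd.tsum_eq,
    ENNReal.tsum_sigma']
  refine tsum_congr fun n => ?_
  rw [tsum_fintype, ← Finset.sum_coe_sort]
  rfl

-- The weight splits as `n + 1 = (i + 1) + ((n - 1 - i) + 1)`.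
open scoped ENNReal in
lemma ENNReal.tsum_shifted_convolution_moment (f g : ℕ → ℝ≥0∞) :
    ∑' n : ℕ, ((n : ℝ≥0∞) + 1) * ∑ i ∈ Finset.range n, f i * g (n - 1 - i) =
      (∑' n : ℕ, ((n : ℝ≥0∞) + 1) * f n) * (∑' n, g n) +
      (∑' n, f n) * ∑' n : ℕ, ((n : ℝ≥0∞) + 1) * g n := by
  rw [← ENNReal.tsum_shifted_convolution, ← ENNReal.tsum_shifted_convolution, ← ENNReal.tsum_add]
  refine tsum_congr fun n => ?_
  rw [← Finset.sum_add_distrib, Finset.mul_sum]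
  refine Finset.sum_congr rfl fun i hi => ?_
  obtain ⟨k, rfl⟩ : ∃ k, n = i + 1 + k := ⟨n - 1 - i, by have := Finset.mem_range.1 hi; omega⟩
  rw [show i + 1 + k - 1 - i = k by omega]
  push_cast
  ring

/-- Consequences of the renewal decomposition for the total masses. -/
lemma mass_relations {M : ℕ} (hM : 1 ≤ M) {Q A D Q' : ℝ} (hQ : HasSum (successMass M) Q)
    (hA : HasSum (aliveMass M) A) (hD : HasSum (fun n : ℕ => ((n : ℝ) + 1) * aliveMass M n) D)
    (hQ' : HasSum (successMass (M + 1)) Q') (hpos : 0 < Q) :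
    ∃ D', HasSum (aliveMass (M + 1)) (Q' / Q * (2 + A)) ∧
      HasSum (fun n : ℕ => ((n : ℝ) + 1) * aliveMass (M + 1) n) D' ∧
      D' ≤ (2 + A) / Q + Q' / Q * D := by
  have hQ'0 : 0 ≤ Q' := hQ'.nonneg (successMass_nonneg _)
  have hA0 : 0 ≤ A := hA.nonneg (aliveMass_nonneg _)
  have hD0 : 0 ≤ D := hD.nonneg fun n => mul_nonneg (by positivity) (aliveMass_nonneg M n)
  have hmul : ∀ (n : ℕ) (r : ℝ), ENNReal.ofReal (((n : ℝ) + 1) * r) =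
      ((n : ENNReal) + 1) * ENNReal.ofReal r := fun n r => by
    rw [ENNReal.ofReal_mul (by positivity), ENNReal.ofReal_add (by positivity) zero_le_one,
      ENNReal.ofReal_natCast, ENNReal.ofReal_one]
  -- The convolutions are summed in `ENNReal`, where no summability of the renewal masses is needed
  -- beforehand. The factor `1 / 2` in `V` is the direct step up that keeps the renewal site.
  obtain ⟨V, hV⟩ : ∃ V : ℕ → ENNReal,
    ∀ i, V i = ENNReal.ofReal (renewalMass (M + 1) i * (1 / 2)) := ⟨_, fun _ => rfl⟩
  obtain ⟨X, hXM⟩ : ∃ X : ℕ → ENNReal, ∀ j, X j = ENNReal.ofReal (successMass M j) :=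
    ⟨_, fun _ => rfl⟩
  obtain ⟨Y, hYM⟩ : ∃ Y : ℕ → ENNReal, ∀ j, Y j = ENNReal.ofReal (aliveMass M j) :=
    ⟨_, fun _ => rfl⟩
  have hV0 : ∀ i, 0 ≤ renewalMass (M + 1) i * (1 / 2) := fun i =>
    mul_nonneg (renewalMass_nonneg _ i) (by norm_num)
  have hX : ∀ n, ENNReal.ofReal (successMass (M + 1) n) =
      ∑ i ∈ Finset.range n, V i * X (n - 1 - i) := fun n => by
    rw [successMass_succ hM,
      ENNReal.ofReal_sum_of_nonneg fun i _ => mul_nonneg (hV0 i) (successMass_nonneg _ _)]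
    simp only [hV, hXM, ENNReal.ofReal_mul (hV0 _)]
  have ha : ∀ n, ENNReal.ofReal (aliveMass (M + 1) n) = 2 * V n +
      ∑ i ∈ Finset.range n, V i * Y (n - 1 - i) := fun n => by
    rw [aliveMass_succ hM, ENNReal.ofReal_add (renewalMass_nonneg _ n)
      (Finset.sum_nonneg fun i _ => mul_nonneg (hV0 i) (aliveMass_nonneg _ _)),
      ENNReal.ofReal_sum_of_nonneg fun i _ => mul_nonneg (hV0 i) (aliveMass_nonneg _ _)]
    simp only [hV, hYM, ENNReal.ofReal_mul (hV0 _)]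
    rw [← ENNReal.ofReal_ofNat 2, ← ENNReal.ofReal_mul (by norm_num)]
    congr 2
    ring
  have hsum : ∀ {f : ℕ → ℝ} {S : ℝ}, (∀ n, 0 ≤ f n) → HasSum f S →
      ∑' n, ENNReal.ofReal (f n) = ENNReal.ofReal S := fun hf h => by
    rw [← h.tsum_eq, ENNReal.ofReal_tsum_of_nonneg hf h.summable]
  have hreal : ∀ {f : ℕ → ℝ}, (∀ n, 0 ≤ f n) → ∑' n, ENNReal.ofReal (f n) ≠ ⊤ →
      HasSum f (∑' n, ENNReal.ofReal (f n)).toReal := fun hf h => by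
    have h1 := ENNReal.hasSum_toReal h
    rw [← ENNReal.tsum_toReal_eq fun n => ENNReal.ofReal_ne_top] at h1
    simpa only [ENNReal.toReal_ofReal (hf _)] using h1
  have hXQ : ∑' n, X n = ENNReal.ofReal Q := by
    simpa only [hXM] using hsum (successMass_nonneg _) hQ
  have hYA : ∑' n, Y n = ENNReal.ofReal A := by
    simpa only [hYM] using hsum (aliveMass_nonneg _) hA
  have hYD : ∑' n : ℕ, ((n : ENNReal) + 1) * Y n = ENNReal.ofReal D := by
    have h1 := hsum (fun n => mul_nonneg (by positivity) (aliveMass_nonneg M n)) hD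
    simpa only [hmul, hYM] using h1
  have hv : ∑' n, V n = ENNReal.ofReal (Q' / Q) := by
    have h1 := hsum (successMass_nonneg _) hQ'
    simp only [hX] at h1
    rw [ENNReal.tsum_shifted_convolution, hXQ] at h1
    rw [ENNReal.ofReal_div_of_pos hpos, ← h1, ENNReal.mul_div_cancel_right _ ENNReal.ofReal_ne_top]
    exact (ENNReal.ofReal_pos.2 hpos).ne'
  -- By `mass_balance` the first moment of the success mass for `M + 1` is at most `1`; it dominates
  -- the first moment of `V` times `Q`.
  have hv₁ : ∑' n : ℕ, ((n : ENNReal) + 1) * V n ≤ ENNReal.ofReal (1 / Q) := by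
    have h1 : ∑' n : ℕ, ((n : ENNReal) + 1) * ENNReal.ofReal (successMass (M + 1) n) ≤ 1 := by
      refine ENNReal.tsum_le_of_sum_range_le fun n => ?_
      have h2 := mass_balance (M := M + 1) n
      have h3 := mul_nonneg (show 0 ≤ (n : ℝ) + 1 by positivity) (aliveMass_nonneg (M + 1) n)
      refine (Finset.sum_le_sum_of_subset (Finset.range_mono n.le_succ)).trans ?_
      simp only [← hmul]
      rw [← ENNReal.ofReal_sum_of_nonneg fun k _ => mul_nonneg (by positivity)
        (successMass_nonneg _ k), ENNReal.ofReal_le_one]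
      linarith
    simp only [hX] at h1
    rw [ENNReal.tsum_shifted_convolution_moment, hXQ] at h1
    rw [ENNReal.ofReal_div_of_pos hpos, ENNReal.ofReal_one, ENNReal.le_div_iff_mul_le
      (Or.inl (ENNReal.ofReal_pos.2 hpos).ne') (Or.inl ENNReal.ofReal_ne_top)]
    exact le_self_add.trans h1
  have hsA : ∑' n, ENNReal.ofReal (aliveMass (M + 1) n) = ENNReal.ofReal (Q' / Q * (2 + A)) := by
    simp only [ha]
    rw [ENNReal.tsum_add, ENNReal.tsum_mul_left, ENNReal.tsum_shifted_convolution,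
      hYA, hv, ENNReal.ofReal_mul (by positivity),
      ENNReal.ofReal_add (by norm_num) hA0, ENNReal.ofReal_ofNat]
    ring
  have hsD : ∑' n : ℕ, ENNReal.ofReal (((n : ℝ) + 1) * aliveMass (M + 1) n) ≤
      ENNReal.ofReal ((2 + A) / Q + Q' / Q * D) := by
    have h1 : ∀ n : ℕ, ((n : ENNReal) + 1) * (2 * V n + ∑ i ∈ Finset.range n, V i * Y (n - 1 - i)) =
        2 * (((n : ENNReal) + 1) * V n) +
          ((n : ENNReal) + 1) * ∑ i ∈ Finset.range n, V i * Y (n - 1 - i) := fun n => by ring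
    simp only [hmul, ha, h1]
    rw [ENNReal.tsum_add, ENNReal.tsum_shifted_convolution_moment, hYA, hv,
      hYD, ENNReal.ofReal_add (by positivity) (by positivity), ENNReal.ofReal_mul (by positivity),
      ← add_assoc]
    gcongr
    rw [ENNReal.tsum_mul_left, mul_comm (∑' _, _), ← add_mul, div_eq_mul_one_div (2 + A),
      ENNReal.ofReal_mul (by positivity), ENNReal.ofReal_add (by norm_num) hA0, ENNReal.ofReal_ofNat]
    gcongr
  have hnn : ∀ n : ℕ, 0 ≤ ((n : ℝ) + 1) * aliveMass (M + 1) n := fun n =>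
    mul_nonneg (by positivity) (aliveMass_nonneg _ n)
  refine ⟨_, ?_, hreal hnn (ne_top_of_le_ne_top ENNReal.ofReal_ne_top hsD),
    ENNReal.toReal_le_of_le_ofReal (by positivity) hsD⟩
  have h1 := hreal (aliveMass_nonneg (M + 1)) (by rw [hsA]; exact ENNReal.ofReal_ne_top)
  rwa [hsA, ENNReal.toReal_ofReal (by positivity)] at h1

/-! ### Comparison of the survival mass with `-log Q`. -/

lemma aliveMass_le (M n : ℕ) : aliveMass M n ≤ 1 / ((n : ℝ) + 1) := by
  have h := mass_balance (M := M) n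
  have : 0 ≤ ∑ k ∈ Finset.range (n + 1), ((k : ℝ) + 1) * successMass M k :=
    Finset.sum_nonneg fun k _ => mul_nonneg (by positivity) (successMass_nonneg M k)
  rw [le_div_iff₀ (by positivity)]
  linarith

/-- Successes at heights up to `n + 1` contribute at most `(n + 1) * Q` to the balance. -/
lemma le_aliveMass {M : ℕ} {Q : ℝ} (hQ : HasSum (successMass M) Q) (n : ℕ) :
    1 / ((n : ℝ) + 1) - Q ≤ aliveMass M n := by
  have h := mass_balance (M := M) n
  have h1 : ∑ k ∈ Finset.range (n + 1), ((k : ℝ) + 1) * successMass M k ≤ ((n : ℝ) + 1) * Q := by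
    calc _ ≤ ∑ k ∈ Finset.range (n + 1), ((n : ℝ) + 1) * successMass M k := by
          refine Finset.sum_le_sum fun k hk => ?_
          have : (k : ℝ) ≤ n := by exact_mod_cast Nat.lt_succ_iff.1 (Finset.mem_range.1 hk)
          gcongr
          exact successMass_nonneg M k
      _ ≤ _ := by
          rw [← Finset.mul_sum]
          gcongr
          exact sum_le_hasSum _ (fun k _ => successMass_nonneg M k) hQ
  rw [sub_le_iff_le_add, div_le_iff₀ (by positivity)]
  linarith

/-- If `Q = 0`, the survival masses would be exactly `1 / (n + 1)`, which is not summable. -/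
lemma successMass_sum_pos {M : ℕ} {Q A : ℝ} (hQ : HasSum (successMass M) Q)
    (hA : HasSum (aliveMass M) A) : 0 < Q := by
  refine lt_of_le_of_ne (hQ.nonneg (successMass_nonneg M)) fun h0 => ?_
  subst h0
  have h1 : ∀ n : ℕ, 1 / (((n + 1 : ℕ) : ℝ)) = aliveMass M n := fun n => by
    refine le_antisymm ?_ ?_
    · simpa using le_aliveMass hQ n
    · simpa using aliveMass_le M n
  have h2 : Summable fun n : ℕ => 1 / (((n + 1 : ℕ) : ℝ)) := by simpa only [h1] using hA.summable
  exact Real.not_summable_one_div_natCast ((summable_nat_add_iff 1).1 h2)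

lemma le_sum_aliveMass {M : ℕ} {Q A : ℝ} (hQ : HasSum (successMass M) Q)
    (hA : HasSum (aliveMass M) A) : -Real.log Q - 1 ≤ A := by
  have hpos := successMass_sum_pos hQ hA
  -- The lower bound `1 / (n + 1) - Q` is nonnegative exactly for `n + 1 ≤ 1 / Q`, so the sum is cut
  -- there.
  set K := ⌊1 / Q⌋₊
  have h1 : ∑ n ∈ Finset.range K, (1 / ((n : ℝ) + 1) - Q) ≤ A :=
    (Finset.sum_le_sum fun n _ => le_aliveMass hQ n).trans
      (sum_le_hasSum _ (fun k _ => aliveMass_nonneg M k) hA)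
  have h2 : (K : ℝ) * Q ≤ 1 := by
    rw [← le_div_iff₀ hpos]; exact Nat.floor_le (by positivity)
  have h3 : Real.log (K + 1) ≤ ∑ n ∈ Finset.range K, 1 / ((n : ℝ) + 1) := by
    have := log_add_one_le_harmonic K
    simpa [harmonic] using this
  have h4 : -Real.log Q ≤ Real.log (K + 1) := by
    rw [← Real.log_inv, ← one_div]
    exact Real.log_le_log (by positivity) (Nat.lt_floor_add_one _).le
  rw [Finset.sum_sub_distrib, Finset.sum_const, Finset.card_range, nsmul_eq_mul] at h1
  linarith

/-- Harmonic bound below height about `B`, Markov's inequality with the first moment `D` above it.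
-/
lemma sum_aliveMass_le {M : ℕ} {A D B : ℝ} (hA : HasSum (aliveMass M) A)
    (hD : HasSum (fun n : ℕ => ((n : ℝ) + 1) * aliveMass M n) D) (hDB : D ≤ B) (hB : 1 ≤ B) :
    A ≤ 3 + Real.log B := by
  set K := ⌈B⌉₊
  have hK : B ≤ K := Nat.le_ceil B
  have hKpos : (0 : ℝ) < K := by linarith
  have h1 : ∑ n ∈ Finset.range K, aliveMass M n ≤ 1 + Real.log K := by
    have := harmonic_le_one_add_log K
    refine (Finset.sum_le_sum fun n _ => aliveMass_le M n).trans ?_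
    simpa [harmonic] using this
  have h2 : A ≤ ∑ n ∈ Finset.range K, aliveMass M n + D / K := by
    have h3 := (hasSum_sum_of_ne_finset_zero (f := fun n => if n ∈ Finset.range K then aliveMass M n
      else 0) (s := Finset.range K) (fun n hn => if_neg hn)).add (hD.div_const (K : ℝ))
    have h4 := hasSum_le (fun n => ?_) hA h3
    · refine h4.trans_eq ?_
      congr 1
      exact Finset.sum_congr rfl fun n hn => if_pos hn
    · have hn := aliveMass_nonneg M n
      split_ifs with h
      · have : 0 ≤ ((n : ℝ) + 1) * aliveMass M n / K := by positivity
        linarith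
      · rw [zero_add, le_div_iff₀ hKpos, mul_comm]
        have : (K : ℝ) ≤ n := by exact_mod_cast not_lt.1 (mt Finset.mem_range.2 h)
        gcongr
        linarith
  have h3 : D / K ≤ 1 := by rw [div_le_one hKpos]; linarith
  have h4 : Real.log K ≤ Real.log B + 1 := by
    have h5 : (K : ℝ) ≤ 2 * B := by
      have := Nat.ceil_lt_add_one (show 0 ≤ B by linarith)
      linarith
    have := Real.log_le_log hKpos h5
    rw [Real.log_mul (by norm_num) (by linarith)] at this
    have := Real.log_two_lt_d9
    linarith
  linarith

/-- The probabilities `Q M` of success determine, through the recursion for the masses, a sequence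
`A` that is close to `-log Q`. -/
lemma exists_mass_recursion {Q : ℕ → ℝ} (hQ : ∀ M, 1 ≤ M → HasSum (successMass M) (Q M))
    (hanti : Antitone Q) (hQ1 : ∀ M, Q M ≤ 1) :
    ∃ A : ℕ → ℝ, ∀ M, 2 ≤ M → 0 < Q M ∧ 1 ≤ A M ∧ A M ≤ 2 * M ∧
      A (M + 1) = Q (M + 1) / Q M * (2 + A M) ∧ -Real.log (Q M) - 1 ≤ A M ∧
      A M ≤ -Real.log (Q M) + 2 * Real.log M + 3 := by
  -- As `Q` is antitone, the recursion gives `A (M + 1) ≤ A M + 2` and `D (M + 1) * Q (M + 1) ≤ D M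
  -- * Q M + 2 + A M`. For `M = 1` the initial state is already a success, so both sums vanish.
  have key : ∀ M, 1 ≤ M → ∃ A D, HasSum (aliveMass M) A ∧
      HasSum (fun n : ℕ => ((n : ℝ) + 1) * aliveMass M n) D ∧ A ≤ 2 * M - 2 ∧ D * Q M ≤ (M : ℝ) ^ 2 := by
    intro M hM
    induction M, hM using Nat.le_induction with
    | base =>
      refine ⟨0, 0, ?_, ?_, by norm_num, by norm_num⟩ <;> simp [funext aliveMass_one, hasSum_zero]
    | succ M hM ih =>
      obtain ⟨A, D, hA, hD, hA2, hDM⟩ := ih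
      have hpos := successMass_sum_pos (hQ M hM) hA
      obtain ⟨D', hA', hD', hle⟩ := mass_relations hM (hQ M hM) hA hD (hQ (M + 1) (by omega)) hpos
      have hA0 : 0 ≤ A := hA.nonneg (aliveMass_nonneg M)
      have hD0 : 0 ≤ D := hD.nonneg fun n => mul_nonneg (by positivity) (aliveMass_nonneg M n)
      have hq0 : 0 < Q (M + 1) := successMass_sum_pos (hQ (M + 1) (by omega)) hA'
      have hρ : Q (M + 1) / Q M ≤ 1 := (div_le_one hpos).2 (hanti M.le_succ)
      have hρ0 : 0 ≤ Q (M + 1) / Q M := by positivity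
      refine ⟨_, D', hA', hD', ?_, ?_⟩
      · push_cast
        nlinarith
      · have h1 : D' * Q (M + 1) ≤ ((2 + A) / Q M + Q (M + 1) / Q M * D) * Q (M + 1) := by gcongr
        have h2 : ((2 + A) / Q M + Q (M + 1) / Q M * D) * Q (M + 1) =
            (2 + A) * (Q (M + 1) / Q M) + (Q (M + 1) / Q M) ^ 2 * (D * Q M) := by
          field_simp
        have h3 : (2 + A) * (Q (M + 1) / Q M) ≤ 2 + A := mul_le_of_le_one_right (by positivity) hρ
        have h4 : (Q (M + 1) / Q M) ^ 2 * (D * Q M) ≤ D * Q M :=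
          mul_le_of_le_one_left (by positivity) (pow_le_one₀ hρ0 hρ)
        push_cast
        nlinarith
  choose! A D hA hD hA2 hDQ using key
  refine ⟨A, fun M hM => ?_⟩
  have hM1 : 1 ≤ M := by omega
  have hpos := successMass_sum_pos (hQ M hM1) (hA M hM1)
  refine ⟨hpos, ?_, by linarith [hA2 M hM1], ?_, le_sum_aliveMass (hQ M hM1) (hA M hM1), ?_⟩
  · have h0 : aliveMass M 0 = 1 := by
      rw [aliveMass, topLaw, if_neg (by simp; omega)]
    rw [← h0]
    exact le_hasSum (hA M hM1) 0 fun n _ => aliveMass_nonneg M n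
  · obtain ⟨D', hA', -⟩ := mass_relations hM1 (hQ M hM1) (hA M hM1) (hD M hM1)
      (hQ (M + 1) (by omega)) hpos
    exact (hA (M + 1) (by omega)).unique hA'
  · have hM2 : (1 : ℝ) ≤ M := by exact_mod_cast hM1
    have hB : 1 ≤ (M : ℝ) ^ 2 / Q M := by
      rw [one_le_div hpos]
      exact (hQ1 M).trans (one_le_pow₀ hM2)
    have := sum_aliveMass_le (hA M hM1) (hD M hM1) ((le_div_iff₀ hpos).2 (hDQ M hM1)) hB
    rw [Real.log_div (by positivity) hpos.ne', Real.log_pow] at this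
    push_cast at this
    linarith

/-! ### Asymptotics of the recursion. -/

lemma tendsto_log_div_sqrt_atTop : Tendsto (fun n : ℕ => Real.log n / √n) atTop (𝓝 0) := by
  have h := (isLittleO_log_rpow_atTop (show (0 : ℝ) < 1 / 2 by norm_num)).tendsto_div_nhds_zero
  simpa only [Real.sqrt_eq_rpow, Function.comp_def] using h.comp tendsto_natCast_atTop_atTop

/-- With the logarithmic error frozen at its value for `N`, `A M + 2 ≤ S M + b` for all `M ≤ N`.
Since `log (1 + 2 / A) ≥ 2 / (A + 2)`, each step raises `(S + b) ^ 2` by at least `4`. -/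
lemma le_of_log_recursion {S A : ℕ → ℝ} (hA : ∀ M, 2 ≤ M → 0 < A M)
    (hS : ∀ M, 2 ≤ M → S (M + 1) = S M + Real.log (1 + 2 / A M))
    (hup : ∀ M, 2 ≤ M → A M ≤ S M + 2 * Real.log M + 3) {N : ℕ} (hN : 2 ≤ N) :
    2 * √((N : ℝ) - 2) ≤ S N + 2 * Real.log N + 5 := by
  set b := 2 * Real.log N + 5
  have key : ∀ M, 2 ≤ M → M ≤ N → 0 ≤ S M + b ∧ 4 * ((M : ℝ) - 2) ≤ (S M + b) ^ 2 := by
    intro M hM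
    have hb : ∀ M, 2 ≤ M → M ≤ N → A M + 2 ≤ S M + b := fun M hM hMN => by
      have : Real.log M ≤ Real.log N := Real.log_le_log (by positivity) (by exact_mod_cast hMN)
      have := hup M hM
      simp only [b]; linarith
    induction M, hM using Nat.le_induction with
    | base =>
      intro h
      have := hb 2 le_rfl h
      have := hA 2 le_rfl
      exact ⟨by linarith, by norm_num; positivity⟩
    | succ M hM ih =>
      intro h
      have h1 := hb M hM (by omega)
      have h2 := hA M hM
      have h3 := (ih (by omega)).2
      have h4 : 2 / (S M + b) ≤ Real.log (1 + 2 / A M) := by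
        have h5 := Real.one_sub_inv_le_log_of_pos (show 0 < 1 + 2 / A M by positivity)
        have h6 : 1 - (1 + 2 / A M)⁻¹ = 2 / (A M + 2) := by field_simp; ring
        rw [h6] at h5
        exact (div_le_div_of_nonneg_left (by norm_num) (by linarith) h1).trans h5
      have h7 : 0 < S M + b := by linarith
      have h8 : S M + b + 2 / (S M + b) ≤ S (M + 1) + b := by rw [hS M hM]; linarith
      have h9 : 0 < S M + b + 2 / (S M + b) := by positivity
      refine ⟨by linarith, ?_⟩
      have h10 : (S M + b) ^ 2 + 4 ≤ (S M + b + 2 / (S M + b)) ^ 2 := by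
        have : (S M + b + 2 / (S M + b)) ^ 2 = (S M + b) ^ 2 + 4 + (2 / (S M + b)) ^ 2 := by
          field_simp; ring
        rw [this]
        have := sq_nonneg (2 / (S M + b))
        linarith
      have h11 := pow_le_pow_left₀ h9.le h8 2
      push_cast
      linarith
  obtain ⟨h1, h2⟩ := key N hN le_rfl
  have h3 : 2 * √((N : ℝ) - 2) = √(4 * ((N : ℝ) - 2)) := by
    rw [Real.sqrt_mul (by norm_num)]
    congr 1
    rw [show (4 : ℝ) = 2 ^ 2 by norm_num, Real.sqrt_sq (by norm_num)]
  rw [h3, add_assoc]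
  exact Real.sqrt_le_iff.2 ⟨h1, h2⟩

lemma tendsto_div_sqrt_of_log_recursion {S A : ℕ → ℝ} (hA : ∀ M, 2 ≤ M → 0 < A M)
    (hS : ∀ M, 2 ≤ M → S (M + 1) = S M + Real.log (1 + 2 / A M))
    (hup : ∀ M, 2 ≤ M → A M ≤ S M + 2 * Real.log M + 3)
    (hlow : ∀ M, 2 ≤ M → S M ≤ A M + 2 * Real.log M + 3) :
    Tendsto (fun n : ℕ => S n / √n) atTop (𝓝 2) := by
  have hlog := tendsto_log_div_sqrt_atTop
  have hsqrt : Tendsto (fun n : ℕ => √(n : ℝ)) atTop atTop :=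
    Real.tendsto_sqrt_atTop.comp tendsto_natCast_atTop_atTop
  have hc : Tendsto (fun n : ℕ => (2 * Real.log n + 5) / √n) atTop (𝓝 0) := by
    have := (hlog.const_mul 2).add (hsqrt.inv_tendsto_atTop.const_mul 5)
    simp only [mul_zero, add_zero] at this
    refine this.congr fun n => ?_
    simp only [Pi.inv_apply]; ring
  -- This crude bound suffices to make the logarithmic errors negligible against `S`, whence `A / S
  -- → 1`.
  have hlb : ∀ᶠ n : ℕ in atTop, √n ≤ S n := by
    filter_upwards [hc.eventually (gt_mem_nhds (show (0 : ℝ) < 1 / 2 by norm_num)),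
      eventually_ge_atTop 5] with n hn h5
    have h1 := le_of_log_recursion hA hS hup (show 2 ≤ n by omega)
    have hn5 : (5 : ℝ) ≤ n := by exact_mod_cast h5
    rw [div_lt_iff₀ (by positivity)] at hn
    have h2 : 3 / 4 * √n ≤ √((n : ℝ) - 2) := by
      apply Real.le_sqrt_of_sq_le
      rw [mul_pow, Real.sq_sqrt (by positivity)]
      linarith
    linarith
  have hSA : Tendsto (fun n => A n / S n) atTop (𝓝 1) := by
    rw [tendsto_iff_norm_sub_tendsto_zero]
    refine squeeze_zero' (Eventually.of_forall fun n => norm_nonneg _) ?_ hc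
    filter_upwards [hlb, eventually_ge_atTop 2] with n hn h2
    have hn0 : 0 < √(n : ℝ) := Real.sqrt_pos.2 (by positivity)
    have hS0 : 0 < S n := hn0.trans_le hn
    have h1 := hup n h2
    have h2' := hlow n h2
    rw [Real.norm_eq_abs, div_sub_one hS0.ne', abs_div, abs_of_pos hS0]
    have h3 : |A n - S n| ≤ 2 * Real.log n + 5 := abs_le.2 ⟨by linarith, by linarith⟩
    have := abs_nonneg (A n - S n)
    exact div_le_div₀ (by linarith) h3 hn0 hn
  have hStop : Tendsto S atTop atTop := tendsto_atTop_mono' _ hlb hsqrt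
  have hAtop : Tendsto A atTop atTop := by
    refine (hStop.atTop_mul_pos one_pos hSA).congr' ?_
    filter_upwards [hStop.eventually_gt_atTop 0] with n hn
    field_simp
  have hδA : Tendsto (fun n => A n * Real.log (1 + 2 / A n)) atTop (𝓝 2) :=
    (Real.tendsto_mul_log_one_add_div_atTop 2).comp hAtop
  have hδ : Tendsto (fun n => Real.log (1 + 2 / A n)) atTop (𝓝 0) := by
    have := hδA.mul hAtop.inv_tendsto_atTop
    rw [mul_zero] at this
    refine this.congr' ?_
    filter_upwards [hAtop.eventually_gt_atTop 0] with n hn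
    simp only [Pi.inv_apply]; field_simp
  -- With `δ = log (1 + 2 / A)` the increment is `2 S δ + δ ^ 2`, where `A δ → 2` and `S / A → 1`.
  -- Cesàro averaging then gives `S n ^ 2 / n → 4`.
  have hincr : Tendsto (fun n => S (n + 1) ^ 2 - S n ^ 2) atTop (𝓝 4) := by
    have := ((hδA.mul (hSA.inv₀ one_ne_zero)).const_mul 2).add (hδ.pow 2)
    have e : 2 * (2 * (1 : ℝ)⁻¹) + 0 ^ 2 = 4 := by norm_num
    rw [e] at this
    refine this.congr' ?_
    filter_upwards [hAtop.eventually_gt_atTop 0, hStop.eventually_gt_atTop 0,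
      eventually_ge_atTop 2] with n hn hn' h2
    rw [hS n h2]
    field_simp
    ring
  have hces := hincr.cesaro
  simp only [Finset.sum_range_sub (fun n => S n ^ 2)] at hces
  have h0 : Tendsto (fun n : ℕ => (n : ℝ)⁻¹ * S 0 ^ 2) atTop (𝓝 0) := by
    simpa using (tendsto_inv_atTop_nhds_zero_nat (𝕜 := ℝ)).mul_const (S 0 ^ 2)
  have hsq := (hces.add h0).sqrt
  rw [add_zero, show (4 : ℝ) = 2 ^ 2 by norm_num, Real.sqrt_sq (by norm_num)] at hsq
  refine hsq.congr' ?_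
  filter_upwards [hStop.eventually_gt_atTop 0] with n hn
  rw [← mul_add, sub_add_cancel, Real.sqrt_mul (by positivity), Real.sqrt_sq hn.le, Real.sqrt_inv]
  ring

/-- Asymptotics of a sequence that satisfies the recursion of the success probabilities. -/
lemma tendsto_log_div_sqrt_of_recursion {Q A : ℕ → ℝ} (h : ∀ M, 2 ≤ M → 0 < Q M ∧ 1 ≤ A M ∧
      A M ≤ 2 * M ∧ A (M + 1) = Q (M + 1) / Q M * (2 + A M) ∧ -Real.log (Q M) - 1 ≤ A M ∧
      A M ≤ -Real.log (Q M) + 2 * Real.log M + 3) :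
    Tendsto (fun n : ℕ => Real.log (Q n) / (2 * √n)) atTop (𝓝 (-1)) := by
  have hlogA : ∀ M, 2 ≤ M → 0 ≤ Real.log (A M) ∧ Real.log (A M) ≤ Real.log M + 1 := by
    intro M hM
    obtain ⟨-, h1, h2, -⟩ := h M hM
    refine ⟨Real.log_nonneg h1, ?_⟩
    have h3 := Real.log_le_log (by linarith) h2
    rw [Real.log_mul (by norm_num) (by positivity)] at h3
    have := Real.log_two_lt_d9
    linarith
  have hS : Tendsto (fun n : ℕ => (-Real.log (Q n) + Real.log (A n)) / √n) atTop (𝓝 2) := by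
    refine tendsto_div_sqrt_of_log_recursion (S := fun n => -Real.log (Q n) + Real.log (A n)) (A := A)
      (fun M hM => by linarith [(h M hM).2.1]) (fun M hM => ?_) (fun M hM => ?_) fun M hM => ?_
    · obtain ⟨h0, h1, -, h2, -⟩ := h M hM
      obtain ⟨h0', h1', -⟩ := h (M + 1) (by omega)
      have h3 : 0 < A M := by linarith
      rw [show 1 + 2 / A M = (2 + A M) / A M by field_simp; ring, h2, Real.log_mul (by positivity)
        (by positivity), Real.log_div h0'.ne' h0.ne', Real.log_div (by positivity) h3.ne']
      ring
    · obtain ⟨-, -, -, -, -, h2⟩ := h M hM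
      have := (hlogA M hM).1
      linarith
    · obtain ⟨-, -, -, -, h2, -⟩ := h M hM
      have := (hlogA M hM).2
      have : 0 ≤ Real.log M := Real.log_natCast_nonneg M
      linarith
  have hlog : Tendsto (fun n : ℕ => Real.log (A n) / √n) atTop (𝓝 0) := by
    have hsqrt : Tendsto (fun n : ℕ => √(n : ℝ)) atTop atTop :=
      Real.tendsto_sqrt_atTop.comp tendsto_natCast_atTop_atTop
    have h1 : Tendsto (fun n : ℕ => (Real.log n + 1) / √n) atTop (𝓝 0) := by
      have := tendsto_log_div_sqrt_atTop.add hsqrt.inv_tendsto_atTop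
      rw [add_zero] at this
      refine this.congr fun n => ?_
      simp only [Pi.inv_apply]; ring
    refine squeeze_zero' ?_ ?_ h1
    · filter_upwards [eventually_ge_atTop 2] with n hn
      have := (hlogA n hn).1
      positivity
    · filter_upwards [eventually_ge_atTop 2] with n hn
      have := (hlogA n hn).2
      gcongr
  have := (hlog.sub hS).mul_const (1 / 2)
  norm_num at this
  refine this.congr fun n => ?_
  ring

/-! ### Success probability of the walk and its backward equation. -/

/-- The sites visited exactly once after a step to `y`, if `L` lists those before the step and `h`
is the maximum before the step. -/
def onceAfterStep (h y : ℕ) (L : List ℕ) : List ℕ :=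
  if y = h + 1 then (h + 1) :: L else L.filter (· ≠ y)

/-- Probability that the walk at `y`, with maximum `h` and once visited sites `L`, has `M` sites
visited once at some time within `n` steps before it hits `0`. -/
noncomputable def succProb (M : ℕ) : ℕ → ℕ → ℕ → List ℕ → ℝ
  | 0, _, _, L => if M ≤ L.length then 1 else 0
  | n + 1, y, h, L => if M ≤ L.length then 1 else if y = 0 then 0 else
      1 / 2 * succProb M n (y + 1) (max h (y + 1)) (onceAfterStep h (y + 1) L) +
      1 / 2 * succProb M n (y - 1) h (onceAfterStep h (y - 1) L)

lemma succProb_mem (M n y h : ℕ) (L : List ℕ) : 0 ≤ succProb M n y h L ∧ succProb M n y h L ≤ 1 := by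
  induction n generalizing y h L with
  | zero => unfold succProb; split_ifs <;> norm_num
  | succ n ih =>
    unfold succProb
    split_ifs
    · norm_num
    · norm_num
    · have h1 := ih (y + 1) (max h (y + 1)) (onceAfterStep h (y + 1) L)
      have h2 := ih (y - 1) h (onceAfterStep h (y - 1) L)
      constructor <;> linarith

lemma succProb_le_succ (M n y h : ℕ) (L : List ℕ) : succProb M n y h L ≤ succProb M (n + 1) y h L := by
  induction n generalizing y h L with
  | zero =>
    have := (succProb_mem M 1 y h L).1
    rw [succProb]
    split_ifs with hM
    · rw [succProb, if_pos hM]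
    · exact this
  | succ n ih =>
    rw [succProb, succProb]
    split_ifs
    · exact le_rfl
    · exact le_rfl
    · have h1 := ih (y + 1) (max h (y + 1)) (onceAfterStep h (y + 1) L)
      have h2 := ih (y - 1) h (onceAfterStep h (y - 1) L)
      linarith

lemma succProb_anti {M M' : ℕ} (hM : M ≤ M') (n y h : ℕ) (L : List ℕ) :
    succProb M' n y h L ≤ succProb M n y h L := by
  induction n generalizing y h L with
  | zero => unfold succProb; split_ifs <;> first | omega | norm_num
  | succ n ih =>
    by_cases h1 : M ≤ L.length
    · rw [succProb.eq_2 M, if_pos h1]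
      exact (succProb_mem _ _ _ _ _).2
    · rw [succProb, succProb, if_neg h1, if_neg (by omega)]
      split_ifs
      · exact le_rfl
      · have h1 := ih (y + 1) (max h (y + 1)) (onceAfterStep h (y + 1) L)
        have h2 := ih (y - 1) h (onceAfterStep h (y - 1) L)
        linarith

/-- Probability of ever having `M` sites visited once. -/
noncomputable def succProbLim (M y h : ℕ) (L : List ℕ) : ℝ := ⨆ n, succProb M n y h L

lemma tendsto_succProb (M y h : ℕ) (L : List ℕ) :
    Tendsto (fun n => succProb M n y h L) atTop (𝓝 (succProbLim M y h L)) :=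
  tendsto_atTop_ciSup (monotone_nat_of_le_succ fun n => succProb_le_succ M n y h L)
    ⟨1, by rintro _ ⟨n, rfl⟩; exact (succProb_mem M n y h L).2⟩

lemma succProbLim_mem (M y h : ℕ) (L : List ℕ) :
    0 ≤ succProbLim M y h L ∧ succProbLim M y h L ≤ 1 :=
  ⟨ge_of_tendsto' (tendsto_succProb M y h L) fun n => (succProb_mem M n y h L).1,
    le_of_tendsto' (tendsto_succProb M y h L) fun n => (succProb_mem M n y h L).2⟩

lemma succProbLim_anti {M M' : ℕ} (hM : M ≤ M') (y h : ℕ) (L : List ℕ) :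
    succProbLim M' y h L ≤ succProbLim M y h L :=
  le_of_tendsto_of_tendsto' (tendsto_succProb M' y h L) (tendsto_succProb M y h L)
    fun n => succProb_anti hM n y h L

lemma succProbLim_of_le {M y h : ℕ} {L : List ℕ} (hM : M ≤ L.length) : succProbLim M y h L = 1 := by
  refine tendsto_nhds_unique (tendsto_succProb M y h L) ?_
  refine tendsto_const_nhds.congr fun n => ?_
  cases n <;> rw [succProb, if_pos hM]

lemma succProbLim_step {M y h : ℕ} {L : List ℕ} (hM : L.length < M) :
    succProbLim M y h L = if y = 0 then 0 else
      1 / 2 * succProbLim M (y + 1) (max h (y + 1)) (onceAfterStep h (y + 1) L) +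
      1 / 2 * succProbLim M (y - 1) h (onceAfterStep h (y - 1) L) := by
  refine tendsto_nhds_unique ((tendsto_add_atTop_iff_nat 1).2 (tendsto_succProb M y h L)) ?_
  simp only [succProb, if_neg (not_le.2 hM)]
  split_ifs
  · exact tendsto_const_nhds
  · exact ((tendsto_succProb _ _ _ _).const_mul _).add ((tendsto_succProb _ _ _ _).const_mul _)

/-- Below its maximum the walk forgets whether the maximum was visited only once. -/
lemma succProb_cons_top {M n y h : ℕ} {K : List ℕ} (hy : y < h) (hM : K.length + 1 < M)
    (hK : h ∉ K) : succProb M n y h (h :: K) = succProb M n y h K := by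
  induction n generalizing y K with
  | zero => simp only [succProb, List.length_cons]; rw [if_neg (by omega), if_neg (by omega)]
  | succ n ih =>
    -- On its way to a new site the walk must pass through `h`, which deletes `h` from the longer
    -- list. Until then the bound on the length of `K` rules out success for both lists.
    have key : ∀ z, z ≤ h → succProb M n z h (onceAfterStep h z (h :: K)) =
        succProb M n z h (onceAfterStep h z K) := by
      intro z hz
      simp only [onceAfterStep, if_neg (show z ≠ h + 1 by omega)]
      rcases hz.eq_or_lt with rfl | hz
      · simp
      · rw [List.filter_cons_of_pos (by simpa using hz.ne')]
        refine ih hz ?_ fun hm => hK (List.mem_of_mem_filter hm)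
        have := K.length_filter_le (fun x => decide (x ≠ z))
        omega
    rw [succProb, succProb, if_neg (by rw [List.length_cons]; omega),
      if_neg (show ¬M ≤ K.length by omega),
      max_eq_left (by omega : y + 1 ≤ h), key _ (by omega), key _ (by omega)]

lemma succProbLim_cons_top {M y h : ℕ} {K : List ℕ} (hy : y < h) (hM : K.length + 1 < M)
    (hK : h ∉ K) : succProbLim M y h (h :: K) = succProbLim M y h K := by
  simp only [succProbLim, succProb_cons_top hy hM hK]

lemma filter_ne_filter_lt {m y : ℕ} (h : m ≤ y) (K : List ℕ) :
    (K.filter (· < m)).filter (· ≠ y) = K.filter (· < m) := by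
  rw [List.filter_eq_self]
  intro x hx
  have := List.of_mem_filter hx
  simp only [decide_eq_true_eq] at this ⊢
  omega

lemma filter_ne_filter_lt_succ (m : ℕ) (K : List ℕ) :
    (K.filter (· < m + 1)).filter (· ≠ m) = K.filter (· < m) := by
  rw [List.filter_filter]
  apply List.filter_congr
  intro x _
  rw [Bool.eq_iff_iff]
  simp only [Bool.and_eq_true, decide_eq_true_eq]
  omega

/-- Gambler's ruin above the running minimum `m`. -/
lemma succProbLim_linear {M m h : ℕ} {K : List ℕ} (hM : K.length < M) (k : ℕ) (hk : m + k ≤ h) :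
    succProbLim M (m + k) h (K.filter (· < m)) = succProbLim M m h (K.filter (· < m)) +
      k / ((h : ℝ) + 1 - m) * (succProbLim M (h + 1) (h + 1) ((h + 1) :: K.filter (· < m)) -
        succProbLim M m h (K.filter (· < m))) := by
  have hlen : (K.filter (· < m)).length < M := (K.length_filter_le _).trans_lt hM
  -- Extended to the exit point `h + 1` by the value after the new maximum, `f` is harmonic, since
  -- the list is unaffected by moves within `[m, h]`.
  set f : ℕ → ℝ := fun k => if m + k = h + 1 then
    succProbLim M (h + 1) (h + 1) ((h + 1) :: K.filter (· < m)) else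
    succProbLim M (m + k) h (K.filter (· < m)) with hf
  have hstep : ∀ k, m + (k + 1) ≤ h → f (k + 2) - f (k + 1) = f (k + 1) - f k := by
    intro k hk
    have h1 : f (k + 1) = 1 / 2 * f (k + 2) + 1 / 2 * f k := by
      simp only [hf]
      rw [if_neg (by omega), if_neg (by omega : m + k ≠ h + 1), succProbLim_step hlen,
        if_neg (by omega), show m + (k + 1) - 1 = m + k by omega]
      have e2 : onceAfterStep h (m + k) (K.filter (· < m)) = K.filter (· < m) := by
        rw [onceAfterStep, if_neg (by omega), filter_ne_filter_lt (by omega)]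
      rw [e2]
      congr 2
      split_ifs with h3
      · have e1 : onceAfterStep h (m + (k + 1) + 1) (K.filter (· < m)) = (h + 1) :: K.filter (· < m) := by
          rw [onceAfterStep, if_pos (by omega)]
        rw [e1, show m + (k + 1) + 1 = h + 1 by omega, max_eq_right (by omega)]
      · have e1 : onceAfterStep h (m + (k + 1) + 1) (K.filter (· < m)) = K.filter (· < m) := by
          rw [onceAfterStep, if_neg (by omega), filter_ne_filter_lt (by omega)]
        rw [e1, max_eq_left (by omega)]; rfl
    linarith
  have hlin : ∀ k, m + k ≤ h + 1 → f k = f 0 + k * (f 1 - f 0) := by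
    have hd : ∀ k, m + (k + 1) ≤ h + 1 → f (k + 1) - f k = f 1 - f 0 := by
      intro k
      induction k with
      | zero => intro _; rfl
      | succ k ih => intro hk; rw [hstep k (by omega), ih (by omega)]
    intro k
    induction k with
    | zero => intro _; simp
    | succ k ih =>
      intro hk
      have := hd k hk
      have := ih (by omega)
      push_cast
      linarith
  have hN := hlin (h + 1 - m) (by omega)
  have hc : ((h + 1 - m : ℕ) : ℝ) = (h : ℝ) + 1 - m := by
    rw [Nat.cast_sub (by omega)]; push_cast; ring
  have hpos : (0 : ℝ) < (h : ℝ) + 1 - m := by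
    rw [← hc]; exact_mod_cast (by omega : 0 < h + 1 - m)
  have hk' := hlin k (by omega)
  have e0 : f 0 = succProbLim M m h (K.filter (· < m)) := by
    simp only [hf]; rw [if_neg (by omega), add_zero]
  have ek : f k = succProbLim M (m + k) h (K.filter (· < m)) := by
    simp only [hf]; rw [if_neg (by omega)]
  have eN : f (h + 1 - m) = succProbLim M (h + 1) (h + 1) ((h + 1) :: K.filter (· < m)) := by
    simp only [hf]; rw [if_pos (by omega)]
  rw [hc] at hN
  rw [← ek, ← eN, ← e0, hk', hN]
  field_simp
  ring

/-- Decomposition of the success probability according to the minimum before the maximum `h` is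
exceeded. -/
lemma succProbLim_at_min {M h : ℕ} {K : List ℕ} (hM : K.length < M) (m : ℕ) (hm : m ≤ h) :
    succProbLim M m h (K.filter (· < m)) = ((h : ℝ) + 1 - m) * ∑ j ∈ Finset.Ico 1 (m + 1),
      1 / (((h : ℝ) + 1 - j) * ((h : ℝ) + 2 - j)) *
        succProbLim M (h + 1) (h + 1) ((h + 1) :: K.filter (· < j)) := by
  have hlen : ∀ m, (K.filter (· < m)).length < M := fun m => (K.length_filter_le _).trans_lt hM
  induction m with
  | zero => rw [succProbLim_step (hlen 0), if_pos rfl]; simp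
  | succ m ih =>
    have hm' : (m : ℝ) + 1 ≤ h := by exact_mod_cast hm
    rw [Finset.sum_Ico_succ_top (by omega), mul_add, ← mul_assoc]
    have h1 := succProbLim_step (y := m + 1) (h := h) (hlen (m + 1))
    rw [if_neg (by omega)] at h1
    -- A step up from the minimum either exceeds the maximum, when `m + 1 = h`, or leads to
    -- gambler's ruin one unit above the minimum.
    have h2 : succProbLim M (m + 1 + 1) (max h (m + 1 + 1))
        (onceAfterStep h (m + 1 + 1) (K.filter (· < m + 1))) =
        succProbLim M (m + 1) h (K.filter (· < m + 1)) +
        1 / ((h : ℝ) + 1 - (m + 1 : ℕ)) *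
          (succProbLim M (h + 1) (h + 1) ((h + 1) :: K.filter (· < m + 1)) -
        succProbLim M (m + 1) h (K.filter (· < m + 1))) := by
      rcases hm.eq_or_lt with rfl | hlt
      · rw [onceAfterStep, if_pos rfl, max_eq_right (by omega)]
        simp
      · have := succProbLim_linear (m := m + 1) hM 1 (by omega : m + 1 + 1 ≤ h)
        rw [onceAfterStep, if_neg (by omega), filter_ne_filter_lt (by omega), max_eq_left (by omega),
          this, Nat.cast_one]
    rw [h2, Nat.add_sub_cancel, onceAfterStep, if_neg (by omega), filter_ne_filter_lt_succ,
      ih (by omega)] at h1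
    have e1 : (h : ℝ) + 1 - (m + 1 : ℕ) ≠ 0 := by push_cast; linarith
    have e2 : (h : ℝ) + 2 - (m + 1 : ℕ) ≠ 0 := by push_cast; linarith
    have e3 : (h : ℝ) + 1 - m = (h : ℝ) + 2 - (m + 1 : ℕ) := by push_cast; ring
    have e4 : (h : ℝ) + 2 - (m + 1 : ℕ) = ((h : ℝ) + 1 - (m + 1 : ℕ)) + 1 := by ring
    rw [e3] at h1
    generalize succProbLim M (m + 1) h (K.filter (· < m + 1)) = E at h1 ⊢
    generalize succProbLim M (h + 1) (h + 1) ((h + 1) :: K.filter (· < m + 1)) = Φ at h1 ⊢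
    generalize (∑ j ∈ Finset.Ico 1 (m + 1), 1 / (((h : ℝ) + 1 - j) * ((h : ℝ) + 2 - j)) *
        succProbLim M (h + 1) (h + 1) ((h + 1) :: K.filter (· < j))) = T at h1 ⊢
    rw [e4] at h1 e2 ⊢
    generalize (h : ℝ) + 1 - (m + 1 : ℕ) = a at *
    field_simp at h1 ⊢
    linarith

/-- The success probability at a new maximum satisfies the backward equation of the chain of
maxima. -/
lemma succProbLim_top {M s : ℕ} {L : List ℕ} (hL : IsTopState (s + 1) L) (hM : L.length < M) :
    succProbLim M (s + 1) (s + 1) L =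
      topStep M (s + 1) (succProbLim M (s + 2) (s + 2)) L := by
  obtain ⟨K, rfl, hK⟩ := hL
  rw [List.length_cons] at hM
  have hlen : (K.filter (· < s)).length + 1 < M :=
    (Nat.add_le_add_right (K.length_filter_le _) 1).trans_lt hM
  have e1 : onceAfterStep (s + 1) s ((s + 1) :: K) = (s + 1) :: K.filter (· < s) := by
    rw [onceAfterStep, if_neg (by omega), List.filter_cons_of_pos (by simp)]
    congr 1
    have h1 : K.filter (· < s + 1) = K := List.filter_eq_self.2 fun x hx => decide_eq_true (hK x hx)
    rw [← filter_ne_filter_lt_succ, h1]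
  have e2 : ∀ j ∈ Finset.Ico 1 (s + 1), ((s + 1) :: K).filter (· < j) = K.filter (· < j) :=
    fun j hj => by
      have := (Finset.mem_Ico.1 hj).2
      rw [List.filter_cons_of_neg (by simp; omega)]
  rw [succProbLim_step (by rwa [List.length_cons]), if_neg (by omega), Nat.add_sub_cancel, e1,
    succProbLim_cons_top (by omega) hlen fun hm => by
      have := hK _ (List.mem_of_mem_filter hm); omega,
    succProbLim_at_min (by omega) s (by omega), topStep, if_neg (by rw [List.length_cons]; omega),
    max_eq_right (by omega), onceAfterStep, if_pos rfl]
  congr 1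
  rw [← mul_assoc, show (1 / 2 : ℝ) * (((s + 1 : ℕ) : ℝ) + 1 - s) = 1 by push_cast; ring, one_mul]
  exact Finset.sum_congr rfl fun j hj => by rw [e2 j hj]

/-- Iterating the backward equation splits off the success mass at each new maximum; the remainder
is at most `aliveMass M n`, hence vanishes in the limit. -/
lemma succProbLim_eq_sum_add (M n : ℕ) :
    succProbLim M 1 1 [1] = ∑ k ∈ Finset.range (n + 1), successMass M k +
      topLaw M n fun L => if M ≤ L.length then 0 else succProbLim M (n + 1) (n + 1) L := by
  have hsplit : ∀ n, topLaw M n (succProbLim M (n + 1) (n + 1)) = successMass M n +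
      topLaw M n fun L => if M ≤ L.length then 0 else succProbLim M (n + 1) (n + 1) L := fun n => by
    rw [successMass, ← topLaw_add]
    congr 1
    funext L
    split_ifs with h
    · rw [succProbLim_of_le h, add_zero]
    · rw [zero_add]
  induction n with
  | zero => rw [zero_add, Finset.sum_range_one, ← hsplit 0]; rfl
  | succ n ih =>
    rw [ih, Finset.sum_range_succ _ (n + 1), add_assoc, ← hsplit, topLaw]
    congr 1
    refine topLaw_congr fun L hL => ?_
    split_ifs with h
    · rw [topStep, if_pos h]
    · exact succProbLim_top hL (not_le.1 h)

/-- Success occurs almost surely at a new maximum. -/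
lemma hasSum_successMass (M : ℕ) : HasSum (successMass M) (succProbLim M 1 1 [1]) := by
  rw [hasSum_iff_tendsto_nat_of_nonneg (successMass_nonneg M), ← tendsto_add_atTop_iff_nat 1]
  have h0 : Tendsto (fun n : ℕ => topLaw M n fun L =>
      if M ≤ L.length then 0 else succProbLim M (n + 1) (n + 1) L) atTop (𝓝 0) := by
    refine squeeze_zero (fun n => topLaw_nonneg fun L => ?_) (fun n => ?_)
      tendsto_one_div_add_atTop_nhds_zero_nat
    · split_ifs
      · exact le_rfl
      · exact (succProbLim_mem _ _ _ _).1
    · refine le_trans (topLaw_mono fun L _ => ?_) (aliveMass_le M n)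
      split_ifs
      · exact le_rfl
      · exact (succProbLim_mem _ _ _ _).2
  have h1 := (tendsto_const_nhds (x := succProbLim M 1 1 [1])).sub h0
  rw [sub_zero] at h1
  refine h1.congr fun n => ?_
  rw [succProbLim_eq_sum_add M n, add_sub_cancel_right]

lemma tendsto_log_succProbLim :
    Tendsto (fun M : ℕ => Real.log (succProbLim M 1 1 [1]) / (2 * √M)) atTop (𝓝 (-1)) := by
  obtain ⟨A, hA⟩ := exists_mass_recursion (fun M _ => hasSum_successMass M)
    (fun _ _ h => succProbLim_anti h 1 1 [1]) (fun M => (succProbLim_mem M 1 1 [1]).2)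
  exact tendsto_log_div_sqrt_of_recursion hA

/-! ### From step sequences to the path and its sites visited once. -/

/-- The event whose probability is `succProb`, for the walk with steps `e`. -/
def WalkSucc (M : ℕ) : ℕ → ℕ → ℕ → List ℕ → (ℕ → ℤ) → Prop
  | 0, _, _, L, _ => M ≤ L.length
  | n + 1, y, h, L, e => M ≤ L.length ∨ y ≠ 0 ∧
      ((e 0 = 1 ∧ WalkSucc M n (y + 1) (max h (y + 1)) (onceAfterStep h (y + 1) L) fun k => e (k + 1)) ∨
      (e 0 = -1 ∧ WalkSucc M n (y - 1) h (onceAfterStep h (y - 1) L) fun k => e (k + 1)))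

lemma WalkSucc.mono {M n y h : ℕ} {L : List ℕ} {e : ℕ → ℤ} (hs : WalkSucc M n y h L e) :
    WalkSucc M (n + 1) y h L e := by
  induction n generalizing y h L e with
  | zero => exact Or.inl hs
  | succ n ih =>
    rw [WalkSucc] at hs ⊢
    exact hs.imp_right (And.imp_right (Or.imp (And.imp_right ih) (And.imp_right ih)))

lemma measurableSet_walkSucc {Ω : Type*} [MeasurableSpace Ω] {ξ : ℕ → Ω → ℤ}
    (hξ : ∀ k, Measurable (ξ k)) (M n y h : ℕ) (L : List ℕ) :
    MeasurableSet {ω | WalkSucc M n y h L fun k => ξ k ω} := by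
  induction n generalizing ξ y h L with
  | zero => exact MeasurableSet.const _
  | succ n ih =>
    have h1 := ih (fun k => hξ (k + 1)) (y + 1) (max h (y + 1)) (onceAfterStep h (y + 1) L)
    have h2 := ih (fun k => hξ (k + 1)) (y - 1) h (onceAfterStep h (y - 1) L)
    have h3 : MeasurableSet {ω | ξ 0 ω = 1} := hξ 0 (measurableSet_singleton 1)
    have h4 : MeasurableSet {ω | ξ 0 ω = -1} := hξ 0 (measurableSet_singleton (-1))
    exact (MeasurableSet.const _).union ((MeasurableSet.const _).inter ((h3.inter h1).union (h4.inter h2)))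

lemma measure_walkSucc {Ω : Type*} [MeasurableSpace Ω] {μ : Measure Ω} [IsProbabilityMeasure μ]
    {ξ : ℕ → Ω → ℤ} (hξ : ∀ k, Measurable (ξ k)) (hind : iIndepFun ξ μ)
    (hup : ∀ k, μ {ω | ξ k ω = 1} = 1 / 2) (hdown : ∀ k, μ {ω | ξ k ω = -1} = 1 / 2)
    (M n j y h : ℕ) (L : List ℕ) :
    μ {ω | WalkSucc M n y h L fun k => ξ (j + k) ω} = ENNReal.ofReal (succProb M n y h L) := by
  induction n generalizing j y h L with
  | zero =>
    simp only [WalkSucc, succProb]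
    split_ifs with hM <;> simp [hM]
  | succ n ih =>
    rw [succProb]
    by_cases hM : M ≤ L.length
    · simp [WalkSucc, hM]
    by_cases hy : y = 0
    · simp [WalkSucc, hM, hy]
    rw [if_neg hM, if_neg hy]
    have hinter : ∀ (c : ℤ) (y h : ℕ) (L : List ℕ), μ {ω | ξ j ω = c} = 1 / 2 →
        μ ({ω | ξ j ω = c} ∩ {ω | WalkSucc M n y h L fun k => ξ (j + 1 + k) ω}) =
          ENNReal.ofReal (1 / 2 * succProb M n y h L) := by
      intro c y h L hc
      -- The continuation event is measurable with respect to the steps after `j`, hence independent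
      -- of step `j`.
      have hI := indep_iSup_of_disjoint (fun k => (hξ k).comap_le) hind
        (S := {j}) (T := Set.Ioi j) (by simp)
      have hm1 : MeasurableSet[⨆ i ∈ ({j} : Set ℕ), MeasurableSpace.comap (ξ i) inferInstance]
          {ω | ξ j ω = c} := by
        have : MeasurableSpace.comap (ξ j) inferInstance ≤
          ⨆ i ∈ ({j} : Set ℕ), MeasurableSpace.comap (ξ i) inferInstance :=
            le_iSup₂_of_le j rfl le_rfl
        exact this _ ⟨{c}, measurableSet_singleton c, rfl⟩
      have hm2 : MeasurableSet[⨆ i ∈ Set.Ioi j, MeasurableSpace.comap (ξ i) inferInstance]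
          {ω | WalkSucc M n y h L fun k => ξ (j + 1 + k) ω} := by
        refine @measurableSet_walkSucc Ω (⨆ i ∈ Set.Ioi j, MeasurableSpace.comap (ξ i) inferInstance)
          (fun k => ξ (j + 1 + k)) (fun k => ?_) M n y h L
        rw [measurable_iff_comap_le]
        exact le_iSup₂_of_le (j + 1 + k) (by simp only [Set.mem_Ioi]; omega) le_rfl
      rw [(Indep_iff _ _ μ).1 hI _ _ hm1 hm2, hc, ih, ENNReal.ofReal_mul (by norm_num)]
      congr 1
      rw [ENNReal.ofReal_div_of_pos (by norm_num)]; simp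
    have hset : {ω | WalkSucc M (n + 1) y h L fun k => ξ (j + k) ω} =
        ({ω | ξ j ω = 1} ∩ {ω | WalkSucc M n (y + 1) (max h (y + 1)) (onceAfterStep h (y + 1) L)
          fun k => ξ (j + 1 + k) ω}) ∪
        ({ω | ξ j ω = -1} ∩ {ω | WalkSucc M n (y - 1) h (onceAfterStep h (y - 1) L)
          fun k => ξ (j + 1 + k) ω}) := by
      ext ω
      simp only [WalkSucc, hM, hy, Set.mem_ofPred_eq, Set.mem_union, Set.mem_inter_iff, false_or,
        not_false_eq_true, ne_eq, true_and, add_zero, add_assoc, add_comm 1]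
    rw [hset, measure_union, hinter _ _ _ _ (hup j), hinter _ _ _ _ (hdown j), ENNReal.ofReal_add]
    · exact mul_nonneg (by norm_num) (succProb_mem _ _ _ _ _).1
    · exact mul_nonneg (by norm_num) (succProb_mem _ _ _ _ _).1
    · rw [Set.disjoint_left]
      rintro ω ⟨h1, -⟩ ⟨h2, -⟩
      simp only [Set.mem_ofPred_eq] at h1 h2
      omega
    · exact (hξ j (measurableSet_singleton (-1))).inter
        (measurableSet_walkSucc (fun k => hξ (j + 1 + k)) _ _ _ _ _)

/-- The path `w` visits `z` exactly once up to time `j`. -/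
def VisitsOnce (w : ℕ → ℤ) (j : ℕ) (z : ℤ) : Prop :=
  ∃ i ≤ j, w i = z ∧ ∀ l ≤ j, l ≠ i → w l ≠ z

lemma visitsOnce_succ_of_ne {w : ℕ → ℤ} {j : ℕ} {z : ℤ} (hz : w (j + 1) ≠ z) :
    VisitsOnce w (j + 1) z ↔ VisitsOnce w j z := by
  constructor
  · rintro ⟨i, hi, rfl, h⟩
    have hij : i ≠ j + 1 := by rintro rfl; exact hz rfl
    exact ⟨i, by omega, rfl, fun l hl => h l (by omega)⟩
  · rintro ⟨i, hi, rfl, h⟩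
    refine ⟨i, by omega, rfl, fun l hl hne => ?_⟩
    rcases hl.eq_or_lt with rfl | hl
    · exact hz
    · exact h l (by omega) hne

lemma visitsOnce_succ_self {w : ℕ → ℤ} {j : ℕ} :
    VisitsOnce w (j + 1) (w (j + 1)) ↔ ¬ ∃ i ≤ j, w i = w (j + 1) := by
  constructor
  · rintro ⟨i, hi, hw, h⟩ ⟨l, hl, hwl⟩
    by_cases hij : i = j + 1
    · exact h l (by omega) (by omega) hwl
    · exact h (j + 1) le_rfl (Ne.symm hij) rfl
  · intro h
    exact ⟨j + 1, le_rfl, rfl, fun l hl hne hw => h ⟨l, by omega, hw⟩⟩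

/-- At time `j` the path `w`, which has not hit `0`, is at `y`, has maximum `h`, and `L` lists the
sites that it has visited once. -/
structure PathState (w : ℕ → ℤ) (j y h : ℕ) (L : List ℕ) : Prop where
  pos : w j = y
  ne_zero : ∀ i ≤ j, w i ≠ 0
  visited : ∀ z : ℤ, (∃ i ≤ j, w i = z) ↔ 1 ≤ z ∧ z ≤ h
  nodup : L.Nodup
  mem : ∀ z : ℤ, VisitsOnce w j z ↔ ∃ x ∈ L, (x : ℤ) = z

lemma PathState.ncard {w : ℕ → ℤ} {j y h : ℕ} {L : List ℕ} (hs : PathState w j y h L) :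
    {z | VisitsOnce w j z}.ncard = L.length := by
  have h1 : {z | VisitsOnce w j z} = ((L.toFinset.image ((↑) : ℕ → ℤ) : Finset ℤ) : Set ℤ) := by
    ext z
    simp [hs.mem z]
  rw [h1, Set.ncard_coe_finset, Finset.card_image_of_injective _ Nat.cast_injective,
    List.toFinset_card_of_nodup hs.nodup]

lemma PathState.start {w : ℕ → ℤ} (h : w 0 = 1) : PathState w 0 1 1 [1] where
  pos := by simp [h]
  ne_zero i hi := by obtain rfl : i = 0 := by omega
                     simp [h]
  visited z := by simp [h]; omega
  nodup := by simp
  mem z := by simp [VisitsOnce, h]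

lemma PathState.step {w : ℕ → ℤ} {j y h y' : ℕ} {L : List ℕ} (hs : PathState w j y h L)
    (hw : w (j + 1) = y') (h0 : y' ≠ 0) (hy : y' ≤ y + 1) :
    PathState w (j + 1) y' (max h y') (onceAfterStep h y' L) := by
  have hyh : y ≤ h := by
    have := ((hs.visited y).1 ⟨j, le_rfl, hs.pos⟩).2
    omega
  have hLh : ∀ x ∈ L, x ≤ h := fun x hx => by
    obtain ⟨i, hi, hwi, -⟩ := (hs.mem x).2 ⟨x, hx, rfl⟩
    have := ((hs.visited x).1 ⟨i, hi, hwi⟩).2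
    omega
  refine ⟨hw, fun i hi => ?_, fun z => ?_, ?_, fun z => ?_⟩
  · rcases hi.eq_or_lt with rfl | hi
    · rw [hw]; exact_mod_cast h0
    · exact hs.ne_zero i (by omega)
  · have h1 : (∃ i ≤ j + 1, w i = z) ↔ (∃ i ≤ j, w i = z) ∨ w (j + 1) = z := by
      constructor
      · rintro ⟨i, hi, hwi⟩
        rcases hi.eq_or_lt with rfl | hi
        · exact Or.inr hwi
        · exact Or.inl ⟨i, by omega, hwi⟩
      · rintro (⟨i, hi, hwi⟩ | hwi)
        · exact ⟨i, by omega, hwi⟩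
        · exact ⟨j + 1, le_rfl, hwi⟩
    rw [h1, hs.visited, hw]
    push_cast
    omega
  · unfold onceAfterStep
    split_ifs with h1
    · exact List.nodup_cons.2 ⟨fun hm => by have := hLh _ hm; omega, hs.nodup⟩
    · exact hs.nodup.filter _
  · by_cases hz : w (j + 1) = z
    · subst hz
      rw [visitsOnce_succ_self, hs.visited, hw]
      unfold onceAfterStep
      split_ifs with h1
      · refine iff_of_true (by omega) ⟨h + 1, by simp, by omega⟩
      · refine iff_of_false (by omega) ?_
        rintro ⟨x, hx, hxy⟩
        have := List.of_mem_filter hx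
        simp only [decide_eq_true_eq] at this
        omega
    · rw [visitsOnce_succ_of_ne hz, hs.mem]
      unfold onceAfterStep
      split_ifs with h1
      · simp only [List.mem_cons, exists_eq_or_imp]
        constructor
        · exact Or.inr
        · rintro (h2 | h2)
          · omega
          · exact h2
      · refine exists_congr fun x => and_congr_left fun hx => ?_
        rw [List.mem_filter, iff_self_and]
        intro _
        simp only [decide_eq_true_eq]
        rintro rfl
        exact hz (hw.trans hx)

lemma PathState.walkSucc_iff {w : ℕ → ℤ} (hw : ∀ k, w (k + 1) - w k = 1 ∨ w (k + 1) - w k = -1)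
    {M n j y h : ℕ} {L : List ℕ} (hs : PathState w j y h L) :
    WalkSucc M n y h L (fun k => w (j + k + 1) - w (j + k)) ↔
      ∃ k ≤ n, (∀ i ≤ j + k, w i ≠ 0) ∧ M ≤ {z | VisitsOnce w (j + k) z}.ncard := by
  induction n generalizing j y h L with
  | zero =>
    rw [WalkSucc, ← hs.ncard]
    constructor
    · exact fun h => ⟨0, le_rfl, hs.ne_zero, h⟩
    · rintro ⟨k, hk, -, h⟩
      obtain rfl : k = 0 := by omega
      exact h
  | succ n ih =>
    have hy1 : 1 ≤ y := by
      have := ((hs.visited y).1 ⟨j, le_rfl, hs.pos⟩).1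
      omega
    have hyh : y ≤ h := by
      have := ((hs.visited y).1 ⟨j, le_rfl, hs.pos⟩).2
      omega
    have hsplit : (∃ k ≤ n + 1, (∀ i ≤ j + k, w i ≠ 0) ∧ M ≤ {z | VisitsOnce w (j + k) z}.ncard) ↔
        M ≤ L.length ∨
        ∃ k ≤ n, (∀ i ≤ j + 1 + k, w i ≠ 0) ∧ M ≤ {z | VisitsOnce w (j + 1 + k) z}.ncard := by
      rw [← hs.ncard]
      constructor
      · rintro ⟨k, hk, h1, h2⟩
        cases k with
        | zero => exact Or.inl h2
        | succ k =>
          rw [show j + (k + 1) = j + 1 + k by ring] at h1 h2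
          exact Or.inr ⟨k, by omega, h1, h2⟩
      · rintro (h2 | ⟨k, hk, h1, h2⟩)
        · exact ⟨0, by omega, hs.ne_zero, h2⟩
        · rw [show j + 1 + k = j + (k + 1) by ring] at h1 h2
          exact ⟨k + 1, by omega, h1, h2⟩
    have hshift : (fun k => w (j + (k + 1) + 1) - w (j + (k + 1))) =
        fun k => w (j + 1 + k + 1) - w (j + 1 + k) := by
      funext k
      rw [show j + (k + 1) = j + 1 + k by ring]
    rw [hsplit, WalkSucc, hshift, add_zero]
    by_cases hM : M ≤ L.length
    · simp only [hM, true_or]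
    simp only [hM, false_or, ne_eq, show y ≠ 0 by omega, not_false_eq_true, true_and]
    rcases hw j with hj | hj
    · have hw1 : w (j + 1) = (y + 1 : ℕ) := by have := hs.pos; push_cast; linarith
      rw [← ih (hs.step hw1 (by omega) le_rfl), hj]
      simp
    · have hw1 : w (j + 1) = (y - 1 : ℕ) := by have := hs.pos; push_cast [hy1]; linarith
      rw [hj]
      simp only [show ¬ ((-1 : ℤ) = 1) by norm_num, false_and, false_or, true_and]
      by_cases hy0 : y - 1 = 0
      -- Arrival at `0` adds no site, so the list stays below `M` and the walk dies without success.
      · refine iff_of_false ?_ ?_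
        · have hlen := L.length_filter_le (fun x => decide (x ≠ y - 1))
          have : (onceAfterStep h (y - 1) L).length < M := by
            rw [onceAfterStep, if_neg (by omega)]; omega
          cases n <;> rw [WalkSucc] <;> simp [hy0] <;> simpa [hy0] using this
        · rintro ⟨k, -, h1, -⟩
          exact h1 (j + 1) (by omega) (by rw [hw1, hy0]; rfl)
      · have := hs.step hw1 hy0 (by omega)
        rw [max_eq_left (by omega)] at this
        rw [← ih this]

/-! ### The stopped walk and the conclusion. -/

lemma le_hitZero_iff {Ω : Type*} (W : ℕ → Ω → ℤ) (ω : Ω) (m : ℕ) :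
    WithTop.some (m + 1) ≤ hitZero W ω ↔ ∀ i, 1 ≤ i → i ≤ m → W i ω ≠ 0 := by
  constructor
  · intro h i h1 hi
    refine notMem_of_lt_hittingAfter (s := {0}) (lt_of_lt_of_le ?_ h) h1
    exact WithTop.coe_lt_coe.2 (by omega)
  · intro h
    unfold hitZero hittingAfter
    split_ifs with hex
    · refine WithTop.coe_le_coe.2 ?_
      have h1 : sInf {i : ℕ | 1 ≤ i ∧ W i ω ∈ ({0} : Set ℤ)} ∈ {i : ℕ | 1 ≤ i ∧ W i ω ∈ ({0} : Set ℤ)} :=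
        Nat.sInf_mem hex
      by_contra hlt
      exact h _ h1.1 (by omega) h1.2
    · exact le_top

lemma stoppedWalk_of_le {Ω : Type*} {W : ℕ → Ω → ℤ} {ω : Ω} {m k : ℕ}
    (h : WithTop.some (m + 1) ≤ hitZero W ω) (hk : k ≤ m) : stoppedWalk W k ω = W k ω := by
  have h1 : WithTop.some k ≤ hitZero W ω := le_trans (WithTop.coe_le_coe.2 (by omega)) h
  have h2 : min (WithTop.some k) (hitZero W ω) = WithTop.some k := min_eq_left h1
  exact congrArg (fun t => W (WithTop.untopA t) ω) h2

lemma onceVisited_stoppedWalk {Ω : Type*} {W : ℕ → Ω → ℤ} {ω : Ω} {j : ℕ}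
    (h : WithTop.some (j + 1 + 1) ≤ hitZero W ω) :
    onceVisited (stoppedWalk W) (j + 1) ω = {z | VisitsOnce (fun k => W (k + 1) ω) j z} := by
  ext z
  constructor
  · rintro ⟨k, ⟨hk1, hk⟩, rfl, hl⟩
    obtain ⟨k, rfl⟩ : ∃ k', k = k' + 1 := ⟨k - 1, by omega⟩
    refine ⟨k, by omega, (stoppedWalk_of_le h hk).symm, fun l hlj hne => ?_⟩
    have := hl (l + 1) ⟨by omega, by omega⟩ (by omega)
    rwa [stoppedWalk_of_le h (show l + 1 ≤ j + 1 by omega)] at this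
  · rintro ⟨k, hk, rfl, hl⟩
    refine ⟨k + 1, ⟨by omega, by omega⟩, stoppedWalk_of_le h (by omega), ?_⟩
    rintro l ⟨hl1, hlj⟩ hne
    obtain ⟨l, rfl⟩ : ∃ l', l = l' + 1 := ⟨l - 1, by omega⟩
    rw [stoppedWalk_of_le h hlj]
    exact hl l (by omega) (by omega)

lemma le_maxOnceVisited_iff {Ω : Type*} {W : ℕ → Ω → ℤ} {ω : Ω} {N : ℕ} (hN : 1 ≤ N)
    (h1 : W 1 ω = 1) (hstep : ∀ k, W (k + 2) ω - W (k + 1) ω = 1 ∨ W (k + 2) ω - W (k + 1) ω = -1) :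
    (N : ℕ∞) ≤ maxOnceVisited W ω ↔
      ∃ n, WalkSucc N n 1 1 [1] fun k => W (k + 2) ω - W (k + 1) ω := by
  have key : ∀ n, WalkSucc N n 1 1 [1] (fun k => W (k + 2) ω - W (k + 1) ω) ↔ _ := fun n => by
    have := (PathState.start (w := fun k => W (k + 1) ω) h1).walkSucc_iff hstep (M := N) (n := n)
    simpa only [zero_add] using this
  simp only [key]
  obtain ⟨N, rfl⟩ : ∃ N', N = N' + 1 := ⟨N - 1, by omega⟩
  rw [Nat.cast_add_one, ENat.add_one_le_iff (ENat.natCast_ne_top N), maxOnceVisited]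
  simp only [lt_iSup_iff, Nat.cast_lt, onceVisitedCount]
  constructor
  · rintro ⟨m, ⟨hm, hle⟩, hlt⟩
    obtain ⟨j, rfl⟩ : ∃ j, m = j + 1 := ⟨m - 1, by omega⟩
    rw [onceVisited_stoppedWalk hle] at hlt
    rw [le_hitZero_iff] at hle
    exact ⟨j, j, le_rfl, fun i hi => hle (i + 1) (by omega) (by omega), hlt⟩
  · rintro ⟨n, j, -, hne, hlt⟩
    have hle : WithTop.some (j + 1 + 1) ≤ hitZero W ω := by
      rw [le_hitZero_iff]
      intro i hi1 hi
      obtain ⟨i, rfl⟩ : ∃ i', i = i' + 1 := ⟨i - 1, by omega⟩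
      exact hne i (by omega)
    refine ⟨j + 1, ⟨by omega, hle⟩, ?_⟩
    rw [onceVisited_stoppedWalk hle]
    exact hlt

lemma ofReal_le_coe_iff {M : ℝ} (x : ℕ∞) : ENNReal.ofReal M ≤ (x : ENNReal) ↔ (⌈M⌉₊ : ℕ∞) ≤ x := by
  induction x using ENat.recTopCoe with
  | top => simp
  | coe k =>
    rw [ENat.toENNReal_coe, ENNReal.ofReal_le_natCast, Nat.cast_le, Nat.ceil_le]

lemma IsSimpleRandomWalkFromOne.ae_path {Ω : Type*} [MeasurableSpace Ω] {W : ℕ → Ω → ℤ}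
    {μ : Measure Ω} [IsProbabilityMeasure μ] (hW : IsSimpleRandomWalkFromOne W μ) :
    ∀ᵐ ω ∂μ, W 1 ω = 1 ∧
      ∀ k, W (k + 2) ω - W (k + 1) ω = 1 ∨ W (k + 2) ω - W (k + 1) ω = -1 := by
  refine hW.start.and (ae_all_iff.2 fun k => ?_)
  have hm : Measurable fun ω => W (k + 2) ω - W (k + 1) ω :=
    (hW.measurable _ (by omega)).sub (hW.measurable _ (by omega))
  have h1 : MeasurableSet {ω | W (k + 2) ω - W (k + 1) ω = 1} := hm (measurableSet_singleton 1)
  have h2 : MeasurableSet {ω | W (k + 2) ω - W (k + 1) ω = -1} := hm (measurableSet_singleton (-1))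
  have hd : Disjoint {ω | W (k + 2) ω - W (k + 1) ω = 1} {ω | W (k + 2) ω - W (k + 1) ω = -1} := by
    rw [Set.disjoint_left]
    intro ω ha hb
    simp only [Set.mem_ofPred_eq] at ha hb
    omega
  have h3 := measure_union (μ := μ) hd h2
  rw [hW.step_up (k + 1) (by omega), hW.step_down (k + 1) (by omega), ENNReal.add_halves] at h3
  exact (mem_ae_iff_prob_eq_one (h1.union h2)).2 h3

lemma IsSimpleRandomWalkFromOne.measure_le_maxOnceVisited {Ω : Type*} [MeasurableSpace Ω]
    {W : ℕ → Ω → ℤ} {μ : Measure Ω} [IsProbabilityMeasure μ] (hW : IsSimpleRandomWalkFromOne W μ)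
    {N : ℕ} (hN : 1 ≤ N) :
    μ.real {ω | (N : ℕ∞) ≤ maxOnceVisited W ω} = succProbLim N 1 1 [1] := by
  have hm : ∀ k, Measurable fun ω => W (k + 2) ω - W (k + 1) ω := fun k =>
    (hW.measurable _ (by omega)).sub (hW.measurable _ (by omega))
  have h1 : μ {ω | (N : ℕ∞) ≤ maxOnceVisited W ω} =
      μ (⋃ n, {ω | WalkSucc N n 1 1 [1] fun k => W (k + 2) ω - W (k + 1) ω}) := by
    refine measure_congr (eventuallyEq_set.2 ?_)
    filter_upwards [hW.ae_path] with ω hω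
    rw [Set.mem_iUnion]
    exact le_maxOnceVisited_iff hN hω.1 hω.2
  have h2 := tendsto_measure_iUnion_atTop (μ := μ)
    (s := fun n => {ω | WalkSucc N n 1 1 [1] fun k => W (k + 2) ω - W (k + 1) ω})
    (monotone_nat_of_le_succ fun n ω h => WalkSucc.mono h)
  have h3 : ∀ n, μ {ω | WalkSucc N n 1 1 [1] fun k => W (k + 2) ω - W (k + 1) ω} =
      ENNReal.ofReal (succProb N n 1 1 [1]) := fun n => by
    simpa only [zero_add] using measure_walkSucc hm hW.indep
      (fun k => hW.step_up (k + 1) (by omega)) (fun k => hW.step_down (k + 1) (by omega)) N n 0 1 1 [1]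
  have h4 := tendsto_nhds_unique (h2.congr h3)
    ((ENNReal.continuous_ofReal.tendsto _).comp (tendsto_succProb N 1 1 [1]))
  rw [measureReal_def, h1, h4, ENNReal.toReal_ofReal (succProbLim_mem _ _ _ _).1]

theorem proposition3 {Ω : Type*} [MeasurableSpace Ω] (μ : Measure Ω) [IsProbabilityMeasure μ]
    (W : ℕ → Ω → ℤ) (hW : IsSimpleRandomWalkFromOne W μ) :
    Tendsto
      (fun M : ℝ =>
        Real.log (μ.real {ω | ENNReal.ofReal M ≤ ((maxOnceVisited W ω : ℕ∞) : ENNReal)}) /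
          (2 * Real.sqrt M))
      atTop (𝓝 (-1)) := by
  -- The maximum is integer valued, so the threshold `M` acts as `⌈M⌉₊`, and `√⌈M⌉₊ / √M → 1`
  -- corrects the normalization.
  have h1 := tendsto_log_succProbLim.comp (tendsto_nat_ceil_atTop (α := ℝ))
  have h2 := (tendsto_nat_ceil_div_atTop (R := ℝ)).sqrt
  rw [Real.sqrt_one] at h2
  have h3 := h1.mul h2
  rw [mul_one] at h3
  refine h3.congr' ?_
  filter_upwards [eventually_gt_atTop 0] with M hM
  have hN : 1 ≤ ⌈M⌉₊ := Nat.one_le_ceil_iff.2 hM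
  simp only [ofReal_le_coe_iff, hW.measure_le_maxOnceVisited hN, Function.comp_apply]
  have h4 : (0 : ℝ) < ⌈M⌉₊ := by exact_mod_cast hN
  rw [Real.sqrt_div h4.le]
  have h5 := Real.sqrt_pos.2 h4
  have h6 := Real.sqrt_pos.2 hM
  field_simp
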